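/- Let $d\in\mathbb{N}$ and let $\mathbb{G}$ be one of $\mathbb{Z}^d$, $\mathbb{Z}_+^d$ (with $\nu$ the counting measure), $\mathbb{R}^d$, $\mathbb{R}_+^d$ (with $\nu$ Lebesgue measure); put $F_n=[0,n]^d\cap\mathbb{G}$. Let $(X,\mu,T)$ be an ergodic measure preserving system: $(X,\mu)$ is a standard Borel probability space, $T=(T^j)_{j\in\mathbb{G}}$ is a (jointly measurable) $\mu$-preserving action of $\mathbb{G}$, and every measurable set $A$ with $(T^{j})^{-1}A=A$ for all $j\in\mathbb{G}$ has measure $0$ or $1$. Let $L^2=L^2(X,\mu)$ (complex valued) and $U^jf=f\circ T^j$. A function $f\in L^2$ is almost periodic if the closure of $\{U^jf:j\in\mathbb{G}\}$ in $L^2$ is compact; $H_{ap}$ is the set of these functions. An eigenfunction is an $f\in L^2$, $f\neq 0$, such that for some $w\in\mathbb{R}^d$, $U^jf=e^{2\pi i\langle w,j\rangle}f$ for all $j\in\mathbb{G}$. The system has discrete spectrum if $L^2$ has an orthonormal basis consisting of eigenfunctions, and it is weakly mixing if the system $(X\times X,\mu\times\mu,T\times T)$ is ergodic. For $f\in L^2$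 let $$d_f(x,y)=\limsup_{n\to\infty}\Big(\frac1{\nu(F_n)}\int_{F_n}|f(T^jx)-f(T^jy)|^2\,d\nu(j)\Big)^{1/2}$$ for $x,y$ in the set of generic points of $|f|^2$, i.e. the points $x$ with $\frac1{\nu(F_n)}\int_{F_n}|f(T^jx)|^2\,d\nu(j)\to\int_X|f|^2\,d\mu$. The function $f$ is $\mu$-mean sensitive if there is $\varepsilon>0$ such that every measurable set $A$ with $\mu(A)>0$ contains such points $x,y$ with $d_f(x,y)>\varepsilon$; $H_{ms}$ is the set of $\mu$-mean sensitive functions. Then: 1. $(X,\mu,T)$ has discrete spectrum if and only if no $f\in L^2$ is $\mu$-mean sensitive, and also if and only if $L^2=H_{ap}=H_{ms}^c$. 2. $(X,\mu,T)$ is weakly mixing if and only if every $f\in L^2$ that is not almost everywhere equal to a constant is $\mu$-mean sensitive. -/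

import Mathlib

open MeasureTheory Filter Topology Set
open scoped ENNReal

noncomputable section

namespace MeanSens

/-- The group `ℤ ^ d`, inside `ℝ ^ d`. -/
def intLattice (d : ℕ) : AddSubmonoid (Fin d → ℝ) where
  carrier := {j | ∀ k, ∃ m : ℤ, j k = m}
  zero_mem' := fun _ => ⟨0, by simp⟩
  add_mem' := by
    intro a b ha hb k
    obtain ⟨m, hm⟩ := ha k
    obtain ⟨n, hn⟩ := hb k
    exact ⟨m + n, by simp [hm, hn]⟩

/-- The semigroup `ℤ₊ ^ d`, inside `ℝ ^ d`. -/
def natLattice (d : ℕ) : AddSubmonoid (Fin d → ℝ) where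
  carrier := {j | ∀ k, ∃ m : ℕ, j k = m}
  zero_mem' := fun _ => ⟨0, by simp⟩
  add_mem' := by
    intro a b ha hb k
    obtain ⟨m, hm⟩ := ha k
    obtain ⟨n, hn⟩ := hb k
    exact ⟨m + n, by simp [hm, hn]⟩

/-- The semigroup `ℝ₊ ^ d`, inside `ℝ ^ d`. -/
def posOrthant (d : ℕ) : AddSubmonoid (Fin d → ℝ) where
  carrier := {j | ∀ k, 0 ≤ j k}
  zero_mem' := fun _ => le_refl _
  add_mem' := fun ha hb k => add_nonneg (ha k) (hb k)

/-- The admissible sets of times `𝔾` with their measure `ν`: `ℤ ^ d` or `ℤ₊ ^ d` with the counting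
measure, `ℝ ^ d` or `ℝ₊ ^ d` with Lebesgue measure. -/
inductive IsTimes (d : ℕ) : (𝔾 : AddSubmonoid (Fin d → ℝ)) → Measure 𝔾 → Prop
  | int : IsTimes d (intLattice d) Measure.count
  | nat : IsTimes d (natLattice d) Measure.count
  | real : IsTimes d ⊤ (Measure.comap Subtype.val volume)
  | pos : IsTimes d (posOrthant d) (Measure.comap Subtype.val volume)

/-- The box `F n = [0, n] ^ d` in `𝔾`. -/
def box {d : ℕ} (𝔾 : AddSubmonoid (Fin d → ℝ)) (n : ℕ) : Set 𝔾 :=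
  {j | ∀ k, 0 ≤ (j : Fin d → ℝ) k ∧ (j : Fin d → ℝ) k ≤ n}

/-- A (jointly measurable) measure preserving action of `𝔾` on `(X, μ)`. -/
structure MPSystem {d : ℕ} (𝔾 : AddSubmonoid (Fin d → ℝ)) (X : Type*) [MeasurableSpace X]
    (μ : Measure X) where
  T : 𝔾 → X → X
  measurable_T : Measurable (Function.uncurry T)
  map_zero : ∀ x, T 0 x = x
  map_add : ∀ i j x, T (i + j) x = T i (T j x)
  measurePreserving : ∀ j, MeasurePreserving (T j) μ μ

namespace MPSystem

variable {d : ℕ} {𝔾 : AddSubmonoid (Fin d → ℝ)} {X : Type*} [MeasurableSpace X] {μ : Measure X}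

/-- Every measurable set that is invariant under all `T j` has measure `0` or `1`. -/
def IsErgodic (S : MPSystem 𝔾 X μ) : Prop :=
  ∀ A : Set X, MeasurableSet A → (∀ j, S.T j ⁻¹' A = A) → μ A = 0 ∨ μ A = 1

/-- The product system `T × T` on `(X × X, μ × μ)`. -/
def selfProd [SFinite μ] (S : MPSystem 𝔾 X μ) : MPSystem 𝔾 (X × X) (μ.prod μ) where
  T := fun j p => (S.T j p.1, S.T j p.2)
  measurable_T := by
    have h := S.measurable_T
    exact Measurable.prodMk
      (h.comp (measurable_fst.prodMk (measurable_fst.comp measurable_snd)))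
      (h.comp (measurable_fst.prodMk (measurable_snd.comp measurable_snd)))
  map_zero := fun p => by simp [S.map_zero]
  map_add := fun i j p => by simp [S.map_add]
  measurePreserving := fun j => (S.measurePreserving j).prod (S.measurePreserving j)

def IsWeaklyMixing [SFinite μ] (S : MPSystem 𝔾 X μ) : Prop :=
  S.selfProd.IsErgodic

/-- The Koopman operator `f ↦ f ∘ T j` on `L²(X, μ)`. -/
def koopman (S : MPSystem 𝔾 X μ) (j : 𝔾) (f : Lp ℂ 2 μ) : Lp ℂ 2 μ :=
  Lp.compMeasurePreserving (S.T j) (S.measurePreserving j) f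

/-- The set of almost periodic functions. -/
def Hap (S : MPSystem 𝔾 X μ) : Set (Lp ℂ 2 μ) :=
  {f | IsCompact (closure (range fun j => S.koopman j f))}

def IsEigenfunction (S : MPSystem 𝔾 X μ) (f : Lp ℂ 2 μ) : Prop :=
  f ≠ 0 ∧ ∃ w : Fin d → ℝ, ∀ j : 𝔾,
    S.koopman j f =
      Complex.exp (2 * Real.pi * Complex.I * ((∑ k, w k * (j : Fin d → ℝ) k : ℝ) : ℂ)) • f

/-- `L²(X, μ)` has an orthonormal (Hilbert) basis which consists of eigenfunctions. -/
def HasDiscreteSpectrum (S : MPSystem 𝔾 X μ) : Prop :=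
  ∃ (s : Set (Lp ℂ 2 μ)) (b : HilbertBasis s ℂ (Lp ℂ 2 μ)),
    (∀ i : s, b i = (i : Lp ℂ 2 μ)) ∧ ∀ f ∈ s, S.IsEigenfunction f

/-- `x` is a generic point for `|f|²`: the averages of `|f|²` along the orbit of `x` over the boxes
`F n` converge to `∫ |f|² dμ`. -/
def IsGenericSq (S : MPSystem 𝔾 X μ) (ν : Measure 𝔾) (f : X → ℂ) (x : X) : Prop :=
  Tendsto (fun n : ℕ => (∫⁻ j in box 𝔾 n, ‖f (S.T j x)‖ₑ ^ 2 ∂ν) / ν (box 𝔾 n)) atTop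
    (𝓝 (∫⁻ z, ‖f z‖ₑ ^ 2 ∂μ))

/-- The pseudometric `d_f(x, y)`, with values in `[0, ∞]`. -/
def meanDist (S : MPSystem 𝔾 X μ) (ν : Measure 𝔾) (f : X → ℂ) (x y : X) : ℝ≥0∞ :=
  limsup (fun n : ℕ =>
    ((∫⁻ j in box 𝔾 n, ‖f (S.T j x) - f (S.T j y)‖ₑ ^ 2 ∂ν) / ν (box 𝔾 n)) ^ (1 / 2 : ℝ)) atTop

/-- The set of `μ`-mean sensitive functions; `d_f` is only considered at generic points of `|f|²`. -/
def Hms (S : MPSystem 𝔾 X μ) (ν : Measure 𝔾) : Set (Lp ℂ 2 μ) :=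
  {f | ∃ ε : ℝ, 0 < ε ∧ ∀ A : Set X, MeasurableSet A → 0 < μ A →
    ∃ x ∈ A, ∃ y ∈ A, S.IsGenericSq ν f x ∧ S.IsGenericSq ν f y ∧
      ENNReal.ofReal ε < S.meanDist ν f x y}

end MPSystem

end MeanSens

end

/-!
Everything reduces to the dichotomy between the closed span of the eigenfunctions and its orthogonal
complement: no function in the former is mean sensitive, but every nonzero function in the latter
is.

Of the set of times only the properties collected in `MeanSens.AdmissibleTimes` matter for the
ergodic theorems. From the Vitali covering lemma one obtains Wiener's maximal inequality
(`mul_measure_le_lintegral`). The functions whose averages converge everywhere are dense, because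
the complement of the differences `f ∘ T j - f` consists of invariant functions; so the pointwise
ergodic theorem follows (`IsErgodic.ae_tendsto_avg`). In particular almost every point is generic
for `|f|²`.

* If `f` is a limit of linear combinations of eigenfunctions, then every set of positive measure has
  a subset of positive measure on which a linear combination `g` close to `f` is nearly constant,
  and stays so along the orbits, because an eigenfunction changes by a unimodular factor only. The
  pointwise ergodic theorem controls `f - g` along almost every orbit, so `d_f` is small on the
  subset (`IsErgodic.notMem_Hms_of_mem_closure`). Such an `f` is almost periodic
  (`mem_Hap_of_mem_closure`).
* If `K` is an invariant function of `T × T`, then the integral operator with kernel `K` is compact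
  and commutes with the Koopman operators. Were it nonzero on the complement of the eigenfunctions,
  the spectral theorem would produce there a finite-dimensional invariant space, hence a common
  eigenvector, whose eigenvalues form a measurable character of the times and so are exponentials:
  a contradiction (`kernelOp_eq_zero_of_mem_orthogonal`). Hence for `f` orthogonal to the
  eigenfunctions `f ⊗ conj f` is orthogonal to all invariant functions of `T × T`, and by the mean
  ergodic theorem its averages `1/ν(F n) ∫ f(T j x) conj f(T j y) dν(j)` tend to `0` in `L¹`. For
  almost every pair `(x, y)` they are small infinitely often, and expanding the square
  `|f(T j x) - f(T j y)|²` shows that `d_f(x, y) ≥ √2 ‖f‖`. Every set of positive measure contains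
  such a pair (`mem_Hms_of_inner_tensor`).

For weak mixing, the argument with `f ⊗ conj f` applies to `f` minus its integral, since the
invariant functions of `T × T` are constant. Conversely, eigenfunctions are never mean sensitive, so
that they are constant if all nonconstant functions are mean sensitive; then an invariant kernel
vanishes on functions of mean `0` on both sides, and is itself constant.
-/

noncomputable section

namespace MeanSens

/-! ### Sets of times -/

section Times

/-- The properties of the set of times `𝔾` and of its measure `ν` on which the ergodic theorems
below depend: `ν` is invariant under translations, and it grows like the volume on cubes. -/
structure AdmissibleTimes {d : ℕ} (𝔾 : AddSubmonoid (Fin d → ℝ)) (ν : Measure 𝔾) : Prop where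
  measurableSet : MeasurableSet (𝔾 : Set (Fin d → ℝ))
  measure_image_add : ∀ (i : 𝔾) (s : Set 𝔾), MeasurableSet s → ν ((fun j => i + j) '' s) = ν s
  measure_cube_le : ∀ (c : Fin d → ℝ) (r : ℝ), 0 ≤ r →
    ν {j | (j : Fin d → ℝ) ∈ Metric.closedBall c r} ≤ ENNReal.ofReal ((2 * r + 1) ^ d)
  le_measure_box : ∀ n : ℕ, ENNReal.ofReal ((n : ℝ) ^ d) ≤ ν (box 𝔾 n)

variable {d : ℕ} {𝔾 : AddSubmonoid (Fin d → ℝ)} {ν : Measure 𝔾}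

theorem countable_intLattice (d : ℕ) : (intLattice d : Set (Fin d → ℝ)).Countable := by
  refine (countable_range fun (m : Fin d → ℤ) k => (m k : ℝ)).mono fun j hj => ?_
  choose m hm using hj
  exact ⟨m, funext fun k => (hm k).symm⟩

theorem natLattice_le_intLattice (d : ℕ) : natLattice d ≤ intLattice d := fun _ hj k =>
  let ⟨m, hm⟩ := hj k
  ⟨m, by simp [hm]⟩

/-- Counting measure is admissible on every set of times between `ℤ₊ ^ d` and `ℤ ^ d`. -/
theorem admissibleTimes_count (h1 : natLattice d ≤ 𝔾) (h2 : 𝔾 ≤ intLattice d) :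
    AdmissibleTimes 𝔾 Measure.count where
  measurableSet := ((countable_intLattice d).mono h2).measurableSet
  measure_image_add i s _ := by
    have hc : (𝔾 : Set (Fin d → ℝ)).Countable := (countable_intLattice d).mono h2
    have : Countable 𝔾 := hc.to_subtype
    rw [Measure.count_apply (Set.to_countable _).measurableSet,
      Measure.count_apply (Set.to_countable _).measurableSet]
    rw [Function.Injective.encard_image (add_right_injective i)]
  measure_cube_le c r hr := by
    have hc : (𝔾 : Set (Fin d → ℝ)).Countable := (countable_intLattice d).mono h2
    have : Countable 𝔾 := hc.to_subtype
    have hfl : ∀ (j : 𝔾) k, ((⌊(j : Fin d → ℝ) k⌋ : ℤ) : ℝ) = (j : Fin d → ℝ) k := by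
      intro j k
      obtain ⟨m, hm⟩ := h2 j.2 k
      rw [hm, Int.floor_intCast]
    rw [Measure.count_apply (Set.to_countable _).measurableSet]
    -- The ball contains at most as many points of `𝔾` as of `ℤ ^ d`, and these are counted by
    -- coordinates: an interval of length `2 * r` contains at most `2 * r + 1` integers.
    set P : Finset (Fin d → ℤ) :=
      Fintype.piFinset fun k => Finset.Icc ⌈c k - r⌉ ⌊c k + r⌋ with hP
    have hle : Set.encard {j : 𝔾 | (j : Fin d → ℝ) ∈ Metric.closedBall c r} ≤ P.card := by
      rw [← Set.encard_coe_eq_coe_finsetCard]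
      refine Set.encard_le_encard_of_injOn (f := fun j k => ⌊(j : Fin d → ℝ) k⌋) ?_ ?_
      · intro j hj
        simp only [hP, Fintype.coe_piFinset, Finset.coe_Icc, Set.mem_pi]
        intro k _
        have h := (dist_le_pi_dist (j : Fin d → ℝ) c k).trans (Metric.mem_closedBall.1 hj)
        rw [Real.dist_eq, abs_le, ← hfl j k] at h
        exact ⟨Int.ceil_le.2 (by linarith), Int.le_floor.2 (by linarith)⟩
      · intro i _ j _ hij
        ext k
        rw [← hfl i k, ← hfl j k]
        exact congrArg _ (congrFun hij k)
    have hcard : (P.card : ℝ) ≤ (2 * r + 1) ^ d := by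
      rw [hP, Fintype.card_piFinset]
      push_cast
      refine (Finset.prod_le_prod (g := fun _ => 2 * r + 1) (fun _ _ => Nat.cast_nonneg _)
        fun k _ => ?_).trans (by simp)
      rw [Int.card_Icc]
      rcases le_total (⌊c k + r⌋ + 1 - ⌈c k - r⌉) 0 with h | h
      · rw [Int.toNat_of_nonpos h]; simp; linarith
      · have : (((⌊c k + r⌋ + 1 - ⌈c k - r⌉).toNat : ℤ) : ℝ)
            = ((⌊c k + r⌋ + 1 - ⌈c k - r⌉ : ℤ) : ℝ) := by rw [Int.toNat_of_nonneg h]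
        rw [Int.cast_natCast] at this
        rw [this]
        push_cast
        linarith [Int.floor_le (c k + r), Int.le_ceil (c k - r)]
    calc ((Set.encard {j : 𝔾 | (j : Fin d → ℝ) ∈ Metric.closedBall c r} : ℕ∞) : ℝ≥0∞)
        ≤ ((P.card : ℕ∞) : ℝ≥0∞) := by exact_mod_cast hle
      _ = ENNReal.ofReal P.card := by simp
      _ ≤ _ := ENNReal.ofReal_le_ofReal hcard
  le_measure_box n := by
    have hc : (𝔾 : Set (Fin d → ℝ)).Countable := (countable_intLattice d).mono h2
    have : Countable 𝔾 := hc.to_subtype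
    rw [Measure.count_apply (Set.to_countable _).measurableSet]
    let g : (Fin d → Fin n) → 𝔾 := fun m => ⟨fun k => (m k : ℕ), h1 fun k => ⟨m k, rfl⟩⟩
    have hg : Function.Injective g := by
      intro a b hab
      funext k
      have := congrFun (congrArg Subtype.val hab) k
      simp only [g, Nat.cast_inj] at this
      exact Fin.ext this
    have hle : ((n ^ d : ℕ) : ℕ∞) ≤ Set.encard (box 𝔾 n) := by
      have h : Set.encard (range g) = ((n ^ d : ℕ) : ℕ∞) := by
        rw [← image_univ, hg.encard_image, Set.encard_univ]
        simp
      rw [← h]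
      refine Set.encard_le_encard ?_
      rintro _ ⟨m, rfl⟩ k
      exact ⟨Nat.cast_nonneg _, Nat.cast_le.2 (m k).2.le⟩
    calc ENNReal.ofReal ((n : ℝ) ^ d) = (((n ^ d : ℕ) : ℕ∞) : ℝ≥0∞) := by
          rw [← Nat.cast_pow, ENNReal.ofReal_natCast]; simp
      _ ≤ _ := by exact_mod_cast hle

/-- Lebesgue measure is admissible on every measurable set of times that contains `ℝ₊ ^ d`. -/
theorem admissibleTimes_volume (hm : MeasurableSet (𝔾 : Set (Fin d → ℝ)))
    (h1 : posOrthant d ≤ 𝔾) : AdmissibleTimes 𝔾 (Measure.comap Subtype.val volume) := by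
  have hcomap : ∀ s : Set 𝔾, MeasurableSet s →
      (Measure.comap Subtype.val volume : Measure 𝔾) s = volume (Subtype.val '' s) := fun s hs =>
    Measure.comap_apply _ Subtype.val_injective
      (fun t ht => (MeasurableEmbedding.subtype_coe hm).measurableSet_image.2 ht) _ hs
  have hemb := MeasurableEmbedding.subtype_coe hm
  refine ⟨hm, ?_, ?_, ?_⟩
  · intro i s hs
    have h : Subtype.val '' ((fun j => i + j) '' s)
        = (fun x => (i : Fin d → ℝ) + x) '' (Subtype.val '' s) := by
      simp only [image_image, AddSubmonoid.coe_add]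
    have hs' : MeasurableSet ((fun j => i + j) '' s) := by
      have h' : MeasurableSet (Subtype.val '' ((fun j => i + j) '' s)) := by
        rw [h]
        exact (measurableEmbedding_addLeft _).measurableSet_image.2
          (hemb.measurableSet_image.2 hs)
      exact hemb.measurableSet_image.1 h'
    rw [hcomap _ hs, hcomap _ hs', h, image_add_left, measure_preimage_add]
  · intro c r hr
    have hs : MeasurableSet {j : 𝔾 | (j : Fin d → ℝ) ∈ Metric.closedBall c r} :=
      measurable_subtype_coe Metric.isClosed_closedBall.measurableSet
    rw [hcomap _ hs]
    refine (measure_mono (t := Metric.closedBall c r) ?_).trans ?_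
    · rintro _ ⟨j, hj, rfl⟩
      exact hj
    · rw [Real.volume_pi_closedBall _ hr]
      simp only [Fintype.card_fin]
      exact ENNReal.ofReal_le_ofReal (pow_le_pow_left₀ (by positivity) (by linarith) _)
  · intro n
    have hbox : box 𝔾 n = Subtype.val ⁻¹' Icc (0 : Fin d → ℝ) (fun _ => (n : ℝ)) := by
      ext j
      simp [box, Pi.le_def, forall_and]
    rw [hcomap _ (hbox ▸ measurable_subtype_coe measurableSet_Icc), hbox]
    refine (measure_mono (s := Icc (0 : Fin d → ℝ) (fun _ => (n : ℝ))) ?_).trans' ?_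
    · intro j hj
      exact ⟨⟨j, h1 fun k => hj.1 k⟩, hj, rfl⟩
    · rw [Real.volume_Icc_pi]
      simp [ENNReal.ofReal_pow]

theorem IsTimes.admissibleTimes (h : IsTimes d 𝔾 ν) : AdmissibleTimes 𝔾 ν := by
  cases h with
  | int => exact admissibleTimes_count (natLattice_le_intLattice d) le_rfl
  | nat => exact admissibleTimes_count le_rfl (natLattice_le_intLattice d)
  | real => exact admissibleTimes_volume (by simp) le_top
  | pos =>
    refine admissibleTimes_volume ?_ le_rfl
    have : (posOrthant d : Set (Fin d → ℝ)) = Ici 0 := by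
      ext j; exact Iff.rfl
    rw [this]
    exact measurableSet_Ici

theorem measurableSet_box (n : ℕ) : MeasurableSet (box 𝔾 n) := by
  have hbox : box 𝔾 n = Subtype.val ⁻¹' Icc (0 : Fin d → ℝ) (fun _ => (n : ℝ)) := by
    ext j
    simp [box, Pi.le_def, forall_and]
  rw [hbox]
  exact measurable_subtype_coe measurableSet_Icc

/-- The box `[0, n] ^ d + j` is a closed ball of the sup norm. -/
theorem mem_box_iff_add_mem_closedBall (n : ℕ) (i j : 𝔾) :
    i ∈ box 𝔾 n ↔ ((i + j : 𝔾) : Fin d → ℝ) ∈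
      Metric.closedBall ((j : Fin d → ℝ) + fun _ => (n : ℝ) / 2) ((n : ℝ) / 2) := by
  rw [Metric.mem_closedBall, dist_pi_le_iff (by positivity)]
  refine forall_congr' fun k => ?_
  rw [Real.dist_eq, abs_le]
  simp only [AddSubmonoid.coe_add, Pi.add_apply]
  constructor <;> rintro ⟨h1, h2⟩ <;> constructor <;> linarith

/-- The cube `[-m, n + m] ^ d` in `𝔾`, which contains every translate of `box 𝔾 n` by a time
whose coordinates are at most `m` in absolute value. -/
def bigBox (𝔾 : AddSubmonoid (Fin d → ℝ)) (m n : ℕ) : Set 𝔾 :=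
  {j | (j : Fin d → ℝ) ∈ Metric.closedBall (fun _ => (n : ℝ) / 2) ((n : ℝ) / 2 + m)}

theorem add_mem_bigBox {m n : ℕ} {i : 𝔾} (hi : ‖(i : Fin d → ℝ)‖ ≤ m) {j : 𝔾}
    (hj : j ∈ box 𝔾 n) : i + j ∈ bigBox 𝔾 m n := by
  simp only [bigBox, mem_ofPred_eq, Metric.mem_closedBall]
  rw [dist_pi_le_iff (by positivity)]
  intro k
  have h := (norm_le_pi_norm (i : Fin d → ℝ) k).trans hi
  rw [Real.norm_eq_abs, abs_le] at h
  rw [Real.dist_eq, abs_le]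
  have := hj k
  simp only [AddSubmonoid.coe_add, Pi.add_apply]
  constructor <;> linarith

theorem box_subset_bigBox (m n : ℕ) : box 𝔾 n ⊆ bigBox 𝔾 m n := fun j hj => by
  have := add_mem_bigBox (i := (0 : 𝔾)) (m := m) (by simp) hj
  rwa [zero_add] at this

namespace AdmissibleTimes

variable (hν : AdmissibleTimes 𝔾 ν)
include hν

theorem measure_bigBox_le (m n : ℕ) :
    ν (bigBox 𝔾 m n) ≤ ENNReal.ofReal (((n : ℝ) + 2 * m + 1) ^ d) := by
  refine (hν.measure_cube_le _ _ (by positivity)).trans_eq ?_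
  congr 2; ring

theorem measure_bigBox_ne_top (m n : ℕ) : ν (bigBox 𝔾 m n) ≠ ∞ :=
  ((hν.measure_bigBox_le m n).trans_lt ENNReal.ofReal_lt_top).ne

theorem measure_box_ne_top (n : ℕ) : ν (box 𝔾 n) ≠ ∞ :=
  ne_top_of_le_ne_top (hν.measure_bigBox_ne_top 0 n) (measure_mono (box_subset_bigBox 0 n))

theorem measure_box_ne_zero {n : ℕ} (hn : n ≠ 0) : ν (box 𝔾 n) ≠ 0 := by
  have h := hν.le_measure_box n
  have : (0 : ℝ≥0∞) < ENNReal.ofReal ((n : ℝ) ^ d) := by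
    rw [ENNReal.ofReal_pos]; positivity
  exact (this.trans_le h).ne'

theorem sigmaFinite : SigmaFinite ν := by
  refine ⟨⟨⟨fun m => bigBox 𝔾 m 0, fun _ => trivial,
    fun m => (hν.measure_bigBox_ne_top m 0).lt_top, ?_⟩⟩⟩
  refine eq_univ_of_forall fun j => mem_iUnion.2 ?_
  obtain ⟨m, hm⟩ := exists_nat_ge ‖(j : Fin d → ℝ)‖
  refine ⟨m, ?_⟩
  have := add_mem_bigBox (n := 0) hm (j := (0 : 𝔾)) (fun k => by simp)
  rwa [add_zero] at this

/-- The boxes form a Følner sequence. -/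
theorem tendsto_bigBox_div_box (m : ℕ) :
    Tendsto (fun n => ν.real (bigBox 𝔾 m n) / ν.real (box 𝔾 n)) atTop (𝓝 1) := by
  have hlim : Tendsto (fun n : ℕ => ((1 : ℝ) + (2 * m + 1) * (n : ℝ)⁻¹) ^ d) atTop (𝓝 1) := by
    have h := ((tendsto_inv_atTop_nhds_zero_nat (𝕜 := ℝ)).const_mul ((2 * m + 1 : ℝ))).const_add 1
    simpa using h.pow d
  refine tendsto_of_tendsto_of_tendsto_of_le_of_le' tendsto_const_nhds hlim ?_ ?_
  · filter_upwards [eventually_ne_atTop 0] with n hn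
    have hpos : 0 < ν.real (box 𝔾 n) :=
      ENNReal.toReal_pos (hν.measure_box_ne_zero hn) (hν.measure_box_ne_top n)
    rw [le_div_iff₀ hpos, one_mul]
    exact measureReal_mono (box_subset_bigBox m n) (hν.measure_bigBox_ne_top m n)
  · filter_upwards [eventually_ne_atTop 0] with n hn
    have hn' : (0 : ℝ) < n := by positivity
    have h1 : ν.real (bigBox 𝔾 m n) ≤ ((n : ℝ) + 2 * m + 1) ^ d :=
      ENNReal.toReal_le_of_le_ofReal (by positivity) (hν.measure_bigBox_le m n)
    have h2 : (n : ℝ) ^ d ≤ ν.real (box 𝔾 n) :=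
      (ENNReal.ofReal_le_iff_le_toReal (hν.measure_box_ne_top n)).1 (hν.le_measure_box n)
    have hpos : 0 < (n : ℝ) ^ d := by positivity
    calc ν.real (bigBox 𝔾 m n) / ν.real (box 𝔾 n)
        ≤ ((n : ℝ) + 2 * m + 1) ^ d / (n : ℝ) ^ d :=
          div_le_div₀ (by positivity) h1 hpos h2
      _ = _ := by
        rw [← div_pow]; congr 1; field_simp; ring

theorem measurableEmbedding_add (i : 𝔾) : MeasurableEmbedding fun j : 𝔾 => i + j := by
  have : StandardBorelSpace 𝔾 := hν.measurableSet.standardBorel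
  refine Measurable.measurableEmbedding ?_ (add_right_injective i)
  exact Measurable.subtype_mk (measurable_subtype_coe.const_add _)

/-- Translation by `i` need not be surjective on a semigroup `𝔾`, so that only the restriction of
`ν` to its range appears. -/
theorem map_add (i : 𝔾) :
    ν.map (fun j => i + j) = ν.restrict (range fun j : 𝔾 => i + j) := by
  have he := hν.measurableEmbedding_add i
  ext s hs
  rw [Measure.map_apply he.measurable hs, Measure.restrict_apply hs,
    ← hν.measure_image_add i _ (he.measurable hs), image_preimage_eq_inter_range]

theorem map_add_le (i : 𝔾) : ν.map (fun j => i + j) ≤ ν := by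
  rw [hν.map_add]
  exact Measure.restrict_le_self

end AdmissibleTimes

end Times

/-! ### Ergodic averages and invariant sets -/

section Shift

variable {d : ℕ} {𝔾 : AddSubmonoid (Fin d → ℝ)} {ν : Measure 𝔾}

/-- Translating a bounded function along `𝔾` changes its averages over the boxes by `o(1)`. -/
theorem AdmissibleTimes.tendsto_setAverage_add_sub (hν : AdmissibleTimes 𝔾 ν) {h : 𝔾 → ℂ}
    (hm : Measurable h) {C : ℝ} (hC : ∀ j, ‖h j‖ ≤ C) (i : 𝔾) :
    Tendsto (fun n : ℕ => (⨍ j in box 𝔾 n, h (i + j) ∂ν) - ⨍ j in box 𝔾 n, h j ∂ν)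
      atTop (𝓝 0) := by
  have := hν.sigmaFinite
  obtain ⟨m, hi⟩ := exists_nat_ge ‖(i : Fin d → ℝ)‖
  have he := hν.measurableEmbedding_add i
  have hint : ∀ n, IntegrableOn h (bigBox 𝔾 m n) ν := fun n =>
    Measure.integrableOn_of_bounded (M := C) (hν.measure_bigBox_ne_top m n)
      hm.aestronglyMeasurable (ae_of_all _ hC)
  -- Both the box and its translate lie in the larger box and have the same measure, so that the
  -- integrals over them differ from the one over the larger box by the measure of the boundary.
  have key : ∀ (n : ℕ) (s : Set 𝔾), MeasurableSet s → s ⊆ bigBox 𝔾 m n →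
      ν s = ν (box 𝔾 n) →
      ‖(∫ j in bigBox 𝔾 m n, h j ∂ν) - ∫ j in s, h j ∂ν‖
        ≤ C * (ν.real (bigBox 𝔾 m n) - ν.real (box 𝔾 n)) := by
    intro n s hs hsub hνs
    rw [← setIntegral_sdiff hs (hint n) hsub]
    refine (norm_setIntegral_le_of_norm_le_const
      ((measure_mono sdiff_subset).trans_lt (hν.measure_bigBox_ne_top m n).lt_top)
      fun j _ => hC j).trans_eq ?_
    rw [measureReal_sdiff hsub hs (hν.measure_bigBox_ne_top m n)]
    simp only [measureReal_def, hνs]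
  have htrans : ∀ n, ∫ j in box 𝔾 n, h (i + j) ∂ν = ∫ j in (fun j => i + j) '' box 𝔾 n, h j ∂ν := by
    intro n
    have h1 := he.setIntegral_map (μ := ν) h ((fun j => i + j) '' box 𝔾 n)
    rw [preimage_image_eq _ (add_right_injective i), hν.map_add,
      Measure.restrict_restrict (he.measurableSet_image.2 (measurableSet_box n)),
      inter_eq_left.2 (image_subset_range _ _)] at h1
    exact h1.symm
  have hlim : Tendsto (fun n : ℕ =>
      2 * C * (ν.real (bigBox 𝔾 m n) / ν.real (box 𝔾 n) - 1)) atTop (𝓝 0) := by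
    have := ((hν.tendsto_bigBox_div_box m).sub_const 1).const_mul (2 * C)
    simpa using this
  refine squeeze_zero_norm' ?_ hlim
  filter_upwards [eventually_ne_atTop 0] with n hn
  have hpos : 0 < ν.real (box 𝔾 n) :=
    ENNReal.toReal_pos (hν.measure_box_ne_zero hn) (hν.measure_box_ne_top n)
  have h1 := key n _ (measurableSet_box n) (box_subset_bigBox m n) rfl
  have h2 := key n _ (he.measurableSet_image.2 (measurableSet_box n))
    (by rintro _ ⟨j, hj, rfl⟩; exact add_mem_bigBox hi hj)
    (hν.measure_image_add i _ (measurableSet_box n))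
  rw [setAverage_eq, setAverage_eq, ← smul_sub, norm_smul, htrans, Real.norm_eq_abs, abs_inv,
    abs_of_pos hpos]
  rw [← div_eq_inv_mul, div_le_iff₀ hpos, mul_assoc, sub_mul, div_mul_cancel₀ _ hpos.ne', one_mul]
  calc _ ≤ _ := norm_sub_le_norm_sub_add_norm_sub _ (∫ j in bigBox 𝔾 m n, h j ∂ν) _
    _ ≤ C * (ν.real (bigBox 𝔾 m n) - ν.real (box 𝔾 n))
        + C * (ν.real (bigBox 𝔾 m n) - ν.real (box 𝔾 n)) :=
      add_le_add (by rw [norm_sub_rev]; exact h2) h1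
    _ = _ := by ring

end Shift

namespace MPSystem

variable {d : ℕ} {𝔾 : AddSubmonoid (Fin d → ℝ)} {ν : Measure 𝔾} {X : Type*} [MeasurableSpace X]
  {μ : Measure X}

/-- The average of `g` over the piece of the orbit of `x` with times in the box `[0, n] ^ d`. -/
def avg (S : MPSystem 𝔾 X μ) (ν : Measure 𝔾) (n : ℕ) (g : X → ℂ) (x : X) : ℂ :=
  ⨍ j in box 𝔾 n, g (S.T j x) ∂ν

theorem measurable_orbit (S : MPSystem 𝔾 X μ) (x : X) : Measurable fun j => S.T j x :=
  S.measurable_T.comp (measurable_id.prodMk measurable_const)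

theorem T_T (S : MPSystem 𝔾 X μ) (i j : 𝔾) (x : X) : S.T j (S.T i x) = S.T (i + j) x := by
  rw [add_comm, S.map_add]

theorem measurable_avg (S : MPSystem 𝔾 X μ) [SFinite ν] {g : X → ℂ} (hg : Measurable g) (n : ℕ) :
    Measurable (S.avg ν n g) := by
  have h : Measurable fun p : X × 𝔾 => g (S.T p.2 p.1) :=
    hg.comp (S.measurable_T.comp measurable_swap)
  have he : S.avg ν n g = fun x =>
      (ν.real (box 𝔾 n))⁻¹ • ∫ j in box 𝔾 n, g (S.T j x) ∂ν := funext fun x => setAverage_eq _ _ _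
  rw [he]
  exact (h.stronglyMeasurable.integral_prod_right (ν := ν.restrict (box 𝔾 n))).measurable.const_smul
    (ν.real (box 𝔾 n))⁻¹

theorem tendsto_avg_T_sub (S : MPSystem 𝔾 X μ) (hν : AdmissibleTimes 𝔾 ν) {g : X → ℂ}
    (hg : Measurable g) {C : ℝ} (hC : ∀ x, ‖g x‖ ≤ C) (i : 𝔾) (x : X) :
    Tendsto (fun n => S.avg ν n g (S.T i x) - S.avg ν n g x) atTop (𝓝 0) := by
  have h := hν.tendsto_setAverage_add_sub (h := fun j => g (S.T j x))
    (hg.comp (S.measurable_orbit x)) (fun j => hC _) i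
  simpa only [avg, T_T] using h

/-- In an ergodic system the almost everywhere invariant sets are trivial, too: such a set `E` is
almost everywhere equal to the strictly invariant set of the points where the averages of the
indicator function of `E` tend to `1`. -/
theorem IsErgodic.ae_invariant {S : MPSystem 𝔾 X μ} (hS : S.IsErgodic)
    (hν : AdmissibleTimes 𝔾 ν) [IsProbabilityMeasure μ] {E : Set X} (hE : MeasurableSet E)
    (hinv : ∀ j, ∀ᵐ x ∂μ, S.T j x ∈ E ↔ x ∈ E) : (∀ᵐ x ∂μ, x ∈ E) ∨ (∀ᵐ x ∂μ, x ∉ E) := by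
  have := hν.sigmaFinite
  set g : X → ℂ := E.indicator fun _ => 1 with hg
  have hgm : Measurable g := measurable_const.indicator hE
  have hC : ∀ x, ‖g x‖ ≤ 1 := fun x => by
    by_cases hx : x ∈ E <;> simp [hg, hx]
  set A : Set X := {x | Tendsto (fun n => S.avg ν n g x) atTop (𝓝 1)} with hA
  have hAm : MeasurableSet A :=
    measurableSet_tendsto_fun (fun n => S.measurable_avg hgm n) measurable_const
  have hAinv : ∀ j, S.T j ⁻¹' A = A := by
    intro i
    ext x
    have h := S.tendsto_avg_T_sub hν hgm hC i x
    constructor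
    · intro hx
      have h' := Tendsto.sub hx h
      simpa [A] using h'
    · intro hx
      have h' := Tendsto.add hx h
      simpa [A] using h'
  have hAE : ∀ᵐ x ∂μ, x ∈ A ↔ x ∈ E := by
    have hmeas : MeasurableSet {q : 𝔾 × X | S.T q.1 q.2 ∈ E ↔ q.2 ∈ E} :=
      (S.measurable_T hE).iff (measurable_snd hE)
    filter_upwards [(Measure.ae_ae_comm (μ := ν) (ν := μ) hmeas).1 (ae_of_all _ hinv)] with x hx
    have havg : ∀ n ≠ 0, S.avg ν n g x = g x := by
      intro n hn
      have h1 : ∀ᵐ j ∂ν.restrict (box 𝔾 n), g (S.T j x) = g x := by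
        filter_upwards [ae_restrict_of_ae hx] with j hj
        by_cases hxE : x ∈ E
        · simp [hg, hxE, hj.2 hxE]
        · simp [hg, hxE, mt hj.1 hxE]
      rw [avg, average_congr h1]
      exact setAverage_const (hν.measure_box_ne_zero hn) (hν.measure_box_ne_top n) _
    have hlim : Tendsto (fun n => S.avg ν n g x) atTop (𝓝 (g x)) :=
      tendsto_const_nhds.congr' <| by
        filter_upwards [eventually_ne_atTop 0] with n hn using (havg n hn).symm
    constructor
    · intro hxA
      have h1 := tendsto_nhds_unique hlim hxA
      by_contra hxE
      simp [hg, hxE] at h1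
    · intro hxE
      have : g x = 1 := by simp [hg, hxE]
      rwa [this] at hlim
  rcases hS A hAm hAinv with h | h
  · right
    have : ∀ᵐ x ∂μ, x ∉ A := measure_eq_zero_iff_ae_notMem.1 h
    filter_upwards [this, hAE] with x h1 h2 using mt h2.2 h1
  · left
    have : ∀ᵐ x ∂μ, x ∈ A := mem_ae_iff_prob_eq_one₀ hAm.nullMeasurableSet |>.2 h
    filter_upwards [this, hAE] with x h1 h2 using h2.1 h1

/-- In an ergodic system the functions that are invariant almost everywhere, for each time
separately, are constant. -/
theorem IsErgodic.ae_eq_const {S : MPSystem 𝔾 X μ} (hS : S.IsErgodic)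
    (hν : AdmissibleTimes 𝔾 ν) [IsProbabilityMeasure μ] {h : X → ℂ} (hm : Measurable h)
    (hinv : ∀ j, ∀ᵐ x ∂μ, h (S.T j x) = h x) : ∃ c : ℂ, h =ᵐ[μ] fun _ => c := by
  refine Filter.exists_eventuallyEq_const_of_forall_separating MeasurableSet fun U hU => ?_
  refine hS.ae_invariant hν (E := h ⁻¹' U) (hm hU) fun j => ?_
  filter_upwards [hinv j] with x hx
  rw [mem_preimage, mem_preimage, hx]

end MPSystem

/-! ### The covering lemma and Wiener's maximal inequality -/

section Covering

variable {d : ℕ} {𝔾 : AddSubmonoid (Fin d → ℝ)} {ν : Measure 𝔾}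

/-- The translate `j + [0, n] ^ d` in `𝔾`. -/
def cube (j : 𝔾) (n : ℕ) : Set 𝔾 :=
  {i | (i : Fin d → ℝ) ∈
    Metric.closedBall ((j : Fin d → ℝ) + fun _ => (n : ℝ) / 2) ((n : ℝ) / 2)}

theorem measurableSet_cube (j : 𝔾) (n : ℕ) : MeasurableSet (cube j n) :=
  measurable_subtype_coe Metric.isClosed_closedBall.measurableSet

theorem cube_subset_box {j : 𝔾} {M N n : ℕ} (hj : j ∈ box 𝔾 M) (hn : n ≤ N) :
    cube j n ⊆ box 𝔾 (M + N) := by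
  intro i hi k
  have h := (dist_le_pi_dist _ _ k).trans (Metric.mem_closedBall.1 hi)
  rw [Real.dist_eq, abs_le] at h
  simp only [Pi.add_apply] at h
  have h1 := hj k
  have h2 : (n : ℝ) ≤ N := Nat.cast_le.2 hn
  push_cast
  constructor <;> linarith

/-- This is an inequality only, because in a semigroup `cube j n` may contain times that are not of
the form `i + j`. -/
theorem AdmissibleTimes.lintegral_box_add_le (hν : AdmissibleTimes 𝔾 ν) {ψ : 𝔾 → ℝ≥0∞}
    (hψ : Measurable ψ) (j : 𝔾) (n : ℕ) :
    ∫⁻ i in box 𝔾 n, ψ (i + j) ∂ν ≤ ∫⁻ i in cube j n, ψ i ∂ν := by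
  have he := hν.measurableEmbedding_add j
  have hbox : box 𝔾 n = (fun i => j + i) ⁻¹' cube j n := by
    ext i
    rw [mem_preimage, add_comm]
    exact mem_box_iff_add_mem_closedBall n i j
  simp_rw [add_comm _ j]
  rw [hbox, ← setLIntegral_map (measurableSet_cube j n) hψ he.measurable]
  exact lintegral_mono' (Measure.restrict_mono le_rfl (hν.map_add_le j)) le_rfl

/-- The covering argument behind the maximal inequality. If each point `j` of `J` is the corner of
a cube of bounded size on which the average of `ψ` is at least `α`, then the Vitali covering lemma
selects disjoint ones among these cubes whose enlargements by the factor `5` cover `J`; an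
enlarged cube of side `5 * n` has measure at most `(5 * n + 1) ^ d ≤ 6 ^ d * n ^ d`. -/
theorem AdmissibleTimes.mul_measure_le_lintegral (hν : AdmissibleTimes 𝔾 ν) {ψ : 𝔾 → ℝ≥0∞}
    (hψ : Measurable ψ) (α : ℝ≥0∞) {M N : ℕ} {J : Set 𝔾} (hJ : J ⊆ box 𝔾 M)
    (h : ∀ j ∈ J, ∃ n ≠ 0, n ≤ N ∧ α * ν (box 𝔾 n) ≤ ∫⁻ i in box 𝔾 n, ψ (i + j) ∂ν) :
    α * ν J ≤ 6 ^ d * ∫⁻ i in box 𝔾 (M + N), ψ i ∂ν := by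
  classical
  have h' : ∀ j : 𝔾, ∃ n : ℕ, n ≠ 0 ∧ (j ∈ J → n ≤ N ∧
      α * ν (box 𝔾 n) ≤ ∫⁻ i in box 𝔾 n, ψ (i + j) ∂ν) := by
    intro j
    by_cases hj : j ∈ J
    · obtain ⟨n, h0, h1⟩ := h j hj
      exact ⟨n, h0, fun _ => h1⟩
    · exact ⟨1, one_ne_zero, fun h => absurd h hj⟩
  choose n hn0 hn using h'
  obtain ⟨u, huJ, hdisj, hcov⟩ := Vitali.exists_disjoint_subfamily_covering_enlargement_closedBall
    J (fun j => (j : Fin d → ℝ) + fun _ => (n j : ℝ) / 2) (fun j => (n j : ℝ) / 2) ((N : ℝ) / 2)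
    (fun j hj => by
      have : (n j : ℝ) ≤ N := Nat.cast_le.2 (hn j hj).1
      linarith) 5 (by norm_num)
  have hpos : ∀ j, (0 : ℝ) < n j := fun j => Nat.cast_pos.2 (Nat.pos_of_ne_zero (hn0 j))
  have hu : u.Countable := hdisj.countable_of_nonempty_interior fun j _ =>
    ⟨_, Metric.ball_subset_interior_closedBall (Metric.mem_ball_self (half_pos (hpos j)))⟩
  have hJcov : J ⊆ ⋃ b ∈ u, {j : 𝔾 | (j : Fin d → ℝ) ∈
      Metric.closedBall ((b : Fin d → ℝ) + fun _ => (n b : ℝ) / 2) (5 * ((n b : ℝ) / 2))} := by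
    intro j hj
    obtain ⟨b, hb, hsub⟩ := hcov j hj
    refine mem_iUnion₂.2 ⟨b, hb, hsub ?_⟩
    have := (mem_box_iff_add_mem_closedBall (n j) 0 j).1 fun k => ⟨by simp, by simp⟩
    rwa [zero_add] at this
  have hball : ∀ b : 𝔾, ν {j : 𝔾 | (j : Fin d → ℝ) ∈
      Metric.closedBall ((b : Fin d → ℝ) + fun _ => (n b : ℝ) / 2) (5 * ((n b : ℝ) / 2))}
      ≤ 6 ^ d * ν (box 𝔾 (n b)) := by
    intro b
    have hb1 : (1 : ℝ) ≤ n b := Nat.one_le_cast.2 (Nat.pos_of_ne_zero (hn0 b))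
    calc _ ≤ ENNReal.ofReal ((2 * (5 * ((n b : ℝ) / 2)) + 1) ^ d) :=
          hν.measure_cube_le _ _ (by positivity)
      _ ≤ ENNReal.ofReal (6 ^ d * (n b : ℝ) ^ d) := by
          rw [← mul_pow]
          exact ENNReal.ofReal_le_ofReal (pow_le_pow_left₀ (by positivity) (by linarith) _)
      _ = 6 ^ d * ENNReal.ofReal ((n b : ℝ) ^ d) := by
          rw [ENNReal.ofReal_mul (by positivity), ENNReal.ofReal_pow (by norm_num)]
          simp
      _ ≤ _ := by gcongr; exact hν.le_measure_box _
  calc α * ν J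
      ≤ α * ∑' b : u, 6 ^ d * ν (box 𝔾 (n b)) := by
        gcongr
        exact (measure_mono hJcov).trans ((measure_biUnion_le _ hu _).trans
          (ENNReal.tsum_le_tsum fun b => hball b))
    _ = 6 ^ d * ∑' b : u, α * ν (box 𝔾 (n b)) := by
        rw [ENNReal.tsum_mul_left, ENNReal.tsum_mul_left]
        ring
    _ ≤ 6 ^ d * ∑' b : u, ∫⁻ i in cube (b : 𝔾) (n b), ψ i ∂ν := by
        gcongr with b
        exact (hn b (huJ b.2)).2.trans (hν.lintegral_box_add_le hψ _ _)
    _ = 6 ^ d * ∫⁻ i in ⋃ b ∈ u, cube b (n b), ψ i ∂ν := by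
        rw [lintegral_biUnion hu (fun b _ => measurableSet_cube _ _)]
        intro a ha b hb hab
        exact (hdisj ha hb hab).preimage _
    _ ≤ _ := by
        gcongr
        exact iUnion₂_subset fun b hb => cube_subset_box (hJ (huJ hb)) (hn b (huJ hb)).1

end Covering

namespace MPSystem

variable {d : ℕ} {𝔾 : AddSubmonoid (Fin d → ℝ)} {ν : Measure 𝔾} {X : Type*} [MeasurableSpace X]
  {μ : Measure X}

theorem measurable_lintegral_box (S : MPSystem 𝔾 X μ) [SFinite ν] {φ : X → ℝ≥0∞}
    (hφ : Measurable φ) (n : ℕ) : Measurable fun x => ∫⁻ j in box 𝔾 n, φ (S.T j x) ∂ν :=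
  Measurable.lintegral_prod_right' (f := fun p : X × 𝔾 => φ (S.T p.2 p.1))
    (hφ.comp (S.measurable_T.comp measurable_swap))

theorem lintegral_lintegral_box (S : MPSystem 𝔾 X μ) [SFinite ν] [SFinite μ] {φ : X → ℝ≥0∞}
    (hφ : Measurable φ) (s : Set 𝔾) :
    ∫⁻ x, ∫⁻ j in s, φ (S.T j x) ∂ν ∂μ = ν s * ∫⁻ x, φ x ∂μ := by
  have hm : Measurable (Function.uncurry fun (x : X) (j : 𝔾) => φ (S.T j x)) :=
    hφ.comp (S.measurable_T.comp measurable_swap)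
  rw [lintegral_lintegral_swap hm.aemeasurable]
  simp_rw [(S.measurePreserving _).lintegral_comp hφ]
  rw [lintegral_const, Measure.restrict_apply_univ, mul_comm]

/-- Wiener's maximal inequality, for averages over boxes of bounded size. By the transference
principle it is enough to apply the covering argument to the times in `box 𝔾 N` at which an orbit
is in the exceptional set, and to integrate over `X`. -/
theorem mul_measure_bounded_le_lintegral (S : MPSystem 𝔾 X μ) [SFinite μ]
    (hν : AdmissibleTimes 𝔾 ν) {φ : X → ℝ≥0∞} (hφ : Measurable φ) (α : ℝ≥0∞) (N : ℕ) :
    α * μ {x | ∃ n ≠ 0, n ≤ N ∧ α * ν (box 𝔾 n) ≤ ∫⁻ j in box 𝔾 n, φ (S.T j x) ∂ν}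
      ≤ 18 ^ d * ∫⁻ x, φ x ∂μ := by
  have := hν.sigmaFinite
  set E : Set X := {x | ∃ n ≠ 0, n ≤ N ∧
    α * ν (box 𝔾 n) ≤ ∫⁻ j in box 𝔾 n, φ (S.T j x) ∂ν} with hE
  rcases Nat.eq_zero_or_pos N with hN | hN
  · have : E = ∅ := by
      ext x
      simp only [hE, mem_ofPred_eq, mem_empty_iff_false, iff_false]
      rintro ⟨n, h0, h1, -⟩
      omega
    simp [this]
  have hEm : MeasurableSet E := by
    have : E = ⋃ n : ℕ, {x | n ≠ 0 ∧ n ≤ N ∧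
        α * ν (box 𝔾 n) ≤ ∫⁻ j in box 𝔾 n, φ (S.T j x) ∂ν} := by
      ext x; simp [hE]
    rw [this]
    refine MeasurableSet.iUnion fun n => (MeasurableSet.const (n ≠ 0)).inter
      ((MeasurableSet.const (n ≤ N)).inter
        (measurableSet_le measurable_const (S.measurable_lintegral_box hφ n)))
  have hind : Measurable (E.indicator (1 : X → ℝ≥0∞)) := measurable_one.indicator hEm
  have hx : ∀ x, α * ∫⁻ j in box 𝔾 N, E.indicator 1 (S.T j x) ∂ν
      ≤ 6 ^ d * ∫⁻ j in box 𝔾 (N + N), φ (S.T j x) ∂ν := by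
    intro x
    have hJm : MeasurableSet ((fun j => S.T j x) ⁻¹' E) := S.measurable_orbit x hEm
    have h1 : ∫⁻ j in box 𝔾 N, E.indicator 1 (S.T j x) ∂ν
        = ν (((fun j => S.T j x) ⁻¹' E) ∩ box 𝔾 N) := by
      rw [← Measure.restrict_apply hJm, ← lintegral_indicator_one hJm]
      rfl
    rw [h1]
    refine hν.mul_measure_le_lintegral (hφ.comp (S.measurable_orbit x)) α inter_subset_right ?_
    rintro j ⟨⟨n, h0, hn, h⟩, -⟩
    refine ⟨n, h0, hn, ?_⟩
    simpa only [Function.comp_def, S.map_add] using h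
  have hint : α * (ν (box 𝔾 N) * μ E) ≤ 6 ^ d * (ν (box 𝔾 (N + N)) * ∫⁻ x, φ x ∂μ) := by
    rw [← S.lintegral_lintegral_box hφ, ← lintegral_indicator_one hEm,
      ← S.lintegral_lintegral_box (μ := μ) (φ := E.indicator 1) hind,
      ← lintegral_const_mul _ (S.measurable_lintegral_box hind N),
      ← lintegral_const_mul _ (S.measurable_lintegral_box hφ (N + N))]
    exact lintegral_mono hx
  -- Passing from `[0, 2 * N] ^ d` to `[0, N] ^ d` costs a factor `3 ^ d`, and `6 * 3 = 18`.
  have hdouble : ν (box 𝔾 (N + N)) ≤ 3 ^ d * ν (box 𝔾 N) := by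
    have hN1 : (1 : ℝ) ≤ N := Nat.one_le_cast.2 hN
    calc ν (box 𝔾 (N + N)) ≤ ν (bigBox 𝔾 0 (N + N)) := measure_mono (box_subset_bigBox _ _)
      _ ≤ ENNReal.ofReal ((((N + N : ℕ) : ℝ) + 2 * (0 : ℕ) + 1) ^ d) := hν.measure_bigBox_le _ _
      _ ≤ ENNReal.ofReal (3 ^ d * (N : ℝ) ^ d) := by
          rw [← mul_pow]
          refine ENNReal.ofReal_le_ofReal (pow_le_pow_left₀ (by positivity) ?_ _)
          push_cast
          linarith
      _ = 3 ^ d * ENNReal.ofReal ((N : ℝ) ^ d) := by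
          rw [ENNReal.ofReal_mul (by positivity), ENNReal.ofReal_pow (by norm_num)]
          simp
      _ ≤ _ := by gcongr; exact hν.le_measure_box _
  refine (ENNReal.mul_le_mul_iff_right (hν.measure_box_ne_zero hN.ne')
    (hν.measure_box_ne_top N)).1 ?_
  calc ν (box 𝔾 N) * (α * μ E) = α * (ν (box 𝔾 N) * μ E) := by ring
    _ ≤ 6 ^ d * (3 ^ d * ν (box 𝔾 N) * ∫⁻ x, φ x ∂μ) := hint.trans (by gcongr)
    _ = (6 * 3) ^ d * (ν (box 𝔾 N) * ∫⁻ x, φ x ∂μ) := by rw [mul_pow]; ring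
    _ = ν (box 𝔾 N) * (18 ^ d * ∫⁻ x, φ x ∂μ) := by norm_num; ring

/-- Wiener's maximal inequality: the set where some average of `φ` is at least `α` has measure at
most `18 ^ d / α * ∫ φ`. -/
theorem mul_measure_le_lintegral (S : MPSystem 𝔾 X μ) [SFinite μ]
    (hν : AdmissibleTimes 𝔾 ν) {φ : X → ℝ≥0∞} (hφ : Measurable φ) (α : ℝ≥0∞) :
    α * μ {x | ∃ n ≠ 0, α * ν (box 𝔾 n) ≤ ∫⁻ j in box 𝔾 n, φ (S.T j x) ∂ν}
      ≤ 18 ^ d * ∫⁻ x, φ x ∂μ := by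
  have hU : {x | ∃ n ≠ 0, α * ν (box 𝔾 n) ≤ ∫⁻ j in box 𝔾 n, φ (S.T j x) ∂ν} =
      ⋃ N : ℕ, {x | ∃ n ≠ 0, n ≤ N ∧
        α * ν (box 𝔾 n) ≤ ∫⁻ j in box 𝔾 n, φ (S.T j x) ∂ν} := by
    ext x
    simp only [mem_ofPred_eq, mem_iUnion]
    exact ⟨fun ⟨n, h0, h⟩ => ⟨n, n, h0, le_rfl, h⟩, fun ⟨_, n, h0, _, h⟩ => ⟨n, h0, h⟩⟩
  rw [hU, Monotone.measure_iUnion, ENNReal.mul_iSup]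
  · exact iSup_le fun N => S.mul_measure_bounded_le_lintegral hν hφ α N
  · rintro a b hab x ⟨n, h0, hn, h⟩
    exact ⟨n, h0, hn.trans hab, h⟩

end MPSystem

/-! ### The mean and the pointwise ergodic theorem -/

namespace MPSystem

variable {d : ℕ} {𝔾 : AddSubmonoid (Fin d → ℝ)} {ν : Measure 𝔾} {X : Type*} [MeasurableSpace X]
  {μ : Measure X}

/-- The Koopman operator as a linear isometry. -/
def koopmanIso (S : MPSystem 𝔾 X μ) (j : 𝔾) : Lp ℂ 2 μ →ₗᵢ[ℂ] Lp ℂ 2 μ :=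
  Lp.compMeasurePreservingₗᵢ ℂ (S.T j) (S.measurePreserving j)

theorem koopmanIso_apply (S : MPSystem 𝔾 X μ) (j : 𝔾) (f : Lp ℂ 2 μ) :
    S.koopmanIso j f = S.koopman j f := rfl

theorem coeFn_koopman (S : MPSystem 𝔾 X μ) (j : 𝔾) (f : Lp ℂ 2 μ) :
    S.koopman j f =ᵐ[μ] fun x => f (S.T j x) :=
  Lp.coeFn_compMeasurePreserving f (S.measurePreserving j)

theorem koopmanIso_add (S : MPSystem 𝔾 X μ) (i j : 𝔾) (f : Lp ℂ 2 μ) :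
    S.koopmanIso (i + j) f = S.koopmanIso i (S.koopmanIso j f) := by
  refine Lp.ext ?_
  have h := (S.measurePreserving i).quasiMeasurePreserving.ae (S.coeFn_koopman j f)
  filter_upwards [S.coeFn_koopman (i + j) f, S.coeFn_koopman i (S.koopmanIso j f), h]
    with x h1 h2 h3
  rw [koopmanIso_apply, koopmanIso_apply, h1, h2, koopmanIso_apply, h3, S.T_T]

theorem koopmanIso_comm (S : MPSystem 𝔾 X μ) (i j : 𝔾) (f : Lp ℂ 2 μ) :
    S.koopmanIso i (S.koopmanIso j f) = S.koopmanIso j (S.koopmanIso i f) := by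
  rw [← koopmanIso_add, add_comm, koopmanIso_add]

/-- The functions in `L²` that have a bounded representative all of whose averages along orbits
tend to `0`. -/
def nullAvg (S : MPSystem 𝔾 X μ) (hν : AdmissibleTimes 𝔾 ν) : Submodule ℂ (Lp ℂ 2 μ) where
  carrier := {f | ∃ m : X → ℂ, Measurable m ∧ (∃ C : ℝ, ∀ x, ‖m x‖ ≤ C) ∧ f =ᵐ[μ] m ∧
    ∀ x, Tendsto (fun n => S.avg ν n m x) atTop (𝓝 0)}
  zero_mem' := ⟨0, measurable_zero, ⟨0, by simp⟩, Lp.coeFn_zero _ _ _, fun x => by simp [avg]⟩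
  add_mem' := by
    rintro f g ⟨m, hm, ⟨C, hC⟩, hfm, hlim⟩ ⟨m', hm', ⟨C', hC'⟩, hgm, hlim'⟩
    refine ⟨m + m', hm.add hm',
      ⟨C + C', fun x => (norm_add_le _ _).trans (add_le_add (hC x) (hC' x))⟩,
      (Lp.coeFn_add f g).trans (hfm.add hgm), fun x => ?_⟩
    have hint : ∀ {g : X → ℂ}, Measurable g → ∀ {C : ℝ}, (∀ x, ‖g x‖ ≤ C) → ∀ n,
        IntegrableOn (fun j => g (S.T j x)) (box 𝔾 n) ν := fun hg _ hC n =>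
      Measure.integrableOn_of_bounded (hν.measure_box_ne_top n)
        (hg.comp (S.measurable_orbit x)).aestronglyMeasurable (ae_of_all _ fun j => hC _)
    have h : ∀ n, S.avg ν n (m + m') x = S.avg ν n m x + S.avg ν n m' x := by
      intro n
      simp only [avg, setAverage_eq, Pi.add_apply]
      rw [integral_add (hint hm hC n) (hint hm' hC' n), smul_add]
    simp_rw [h]
    simpa using (hlim x).add (hlim' x)
  smul_mem' := by
    rintro c f ⟨m, hm, ⟨C, hC⟩, hfm, hlim⟩
    refine ⟨c • m, hm.const_smul c, ⟨‖c‖ * C, fun x => ?_⟩,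
      (Lp.coeFn_smul c f).trans (hfm.const_smul c), fun x => ?_⟩
    · rw [Pi.smul_apply, norm_smul]
      exact mul_le_mul_of_nonneg_left (hC x) (norm_nonneg c)
    · have h : ∀ n, S.avg ν n (c • m) x = c • S.avg ν n m x := by
        intro n
        simp only [avg, setAverage_eq, Pi.smul_apply]
        rw [integral_smul, smul_comm]
      simp_rw [h]
      simpa using (hlim x).const_smul c

/-- Only simple `f` are considered, since a general `f` in `L²` has no bounded representative; they
are dense. -/
theorem sub_koopmanIso_mem_nullAvg (S : MPSystem 𝔾 X μ) [IsFiniteMeasure μ]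
    (hν : AdmissibleTimes 𝔾 ν) (f : Lp.simpleFunc ℂ 2 μ) (j : 𝔾) :
    S.koopmanIso j (f : Lp ℂ 2 μ) - f ∈ S.nullAvg hν := by
  set g := Lp.simpleFunc.toSimpleFunc f with hg
  have hfg : ⇑g =ᵐ[μ] (f : Lp ℂ 2 μ) := Lp.simpleFunc.toSimpleFunc_eq_toFun f
  obtain ⟨C, hC⟩ := g.exists_forall_norm_le
  have hgT := g.measurable.comp (S.measurePreserving j).measurable
  refine ⟨fun x => g (S.T j x) - g x, hgT.sub g.measurable,
    ⟨C + C, fun x => (norm_sub_le _ _).trans (add_le_add (hC _) (hC _))⟩, ?_, fun x => ?_⟩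
  · have h := (S.measurePreserving j).quasiMeasurePreserving.ae hfg
    filter_upwards [Lp.coeFn_sub (S.koopmanIso j (f : Lp ℂ 2 μ)) f, S.coeFn_koopman j f, h, hfg]
      with x h1 h2 h3 h4
    rw [h1, Pi.sub_apply, koopmanIso_apply, h2, h3, h4]
  · refine (S.tendsto_avg_T_sub hν g.measurable hC j x).congr fun n => ?_
    have hint : ∀ {g : X → ℂ}, Measurable g → (∀ x, ‖g x‖ ≤ C) →
        IntegrableOn (fun j => g (S.T j x)) (box 𝔾 n) ν := fun hg hC =>
      Measure.integrableOn_of_bounded (hν.measure_box_ne_top n)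
        (hg.comp (S.measurable_orbit x)).aestronglyMeasurable (ae_of_all _ fun j => hC _)
    have hi1 : IntegrableOn (fun i => g (S.T j (S.T i x))) (box 𝔾 n) ν :=
      hint hgT fun x => hC _
    simp only [avg, setAverage_eq]
    rw [integral_sub hi1 (hint g.measurable hC), smul_sub]
    simp only [T_T, add_comm]

/-- The vector `h` is orthogonal to all `U f - f`, where `U` is a Koopman operator. Since `U` is an
isometry, `‖U h - h‖² = -2 * re ⟪U h - h, h⟫ = 0`. -/
theorem koopmanIso_eq_of_mem_orthogonal (S : MPSystem 𝔾 X μ) [IsFiniteMeasure μ]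
    (hν : AdmissibleTimes 𝔾 ν) {h : Lp ℂ 2 μ} (hh : h ∈ (S.nullAvg hν)ᗮ) (j : 𝔾) :
    S.koopmanIso j h = h := by
  have hall : ∀ f : Lp ℂ 2 μ, inner ℂ (S.koopmanIso j f - f) h = 0 := by
    intro f
    refine (Lp.simpleFunc.denseRange (E := ℂ) (μ := μ) (p := 2) (by simp)).induction_on
      (p := fun f => inner ℂ (S.koopmanIso j f - f) h = 0) f
      (isClosed_eq (by fun_prop) continuous_const) fun g => ?_
    exact (Submodule.mem_orthogonal _ _).1 hh _ (S.sub_koopmanIso_mem_nullAvg hν g j)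
  have h1 := hall h
  rw [inner_sub_left, sub_eq_zero] at h1
  rw [← sub_eq_zero, ← inner_self_eq_zero (𝕜 := ℂ), inner_sub_right, hall h, sub_zero,
    inner_sub_left, LinearIsometry.inner_map_map, ← inner_conj_symm h (S.koopmanIso j h), h1,
    inner_conj_symm, sub_self]

theorem mem_closure_nullAvg (S : MPSystem 𝔾 X μ) [IsFiniteMeasure μ]
    (hν : AdmissibleTimes 𝔾 ν) {G : Lp ℂ 2 μ}
    (hG : ∀ K : Lp ℂ 2 μ, (∀ j, S.koopmanIso j K = K) → inner ℂ K G = 0) :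
    G ∈ (S.nullAvg hν).topologicalClosure := by
  rw [← Submodule.orthogonal_orthogonal_eq_closure, Submodule.mem_orthogonal]
  exact fun K hK => hG K fun j => S.koopmanIso_eq_of_mem_orthogonal hν hK j

/-- A function in `L²` that is orthogonal to the fixed vectors is close, in `L¹`, to a bounded
function whose averages tend to `0` everywhere. -/
theorem exists_tendsto_avg_zero (S : MPSystem 𝔾 X μ) [IsProbabilityMeasure μ]
    (hν : AdmissibleTimes 𝔾 ν) {G : Lp ℂ 2 μ}
    (hG : ∀ K : Lp ℂ 2 μ, (∀ j, S.koopmanIso j K = K) → inner ℂ K G = 0) {δ : ℝ≥0∞}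
    (hδ : δ ≠ 0) :
    ∃ m : X → ℂ, Measurable m ∧ (∃ C : ℝ, ∀ x, ‖m x‖ ≤ C) ∧
      (∀ x, Tendsto (fun n => S.avg ν n m x) atTop (𝓝 0)) ∧
      ∫⁻ x, ‖G x - m x‖ₑ ∂μ ≤ δ := by
  obtain ⟨h, ⟨m, hm, hC, hhm, hlim⟩, hdist⟩ :=
    EMetric.mem_closure_iff.1 (S.mem_closure_nullAvg hν hG) δ (pos_iff_ne_zero.2 hδ)
  refine ⟨m, hm, hC, hlim, ?_⟩
  have h1 : ∫⁻ x, ‖G x - m x‖ₑ ∂μ = eLpNorm (⇑G - ⇑h) 1 μ := by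
    rw [eLpNorm_one_eq_lintegral_enorm]
    refine lintegral_congr_ae ?_
    filter_upwards [hhm] with x hx
    rw [Pi.sub_apply, hx]
  rw [h1]
  refine (eLpNorm_le_eLpNorm_of_exponent_le (q := 2) (by norm_num)
    ((Lp.aestronglyMeasurable G).sub (Lp.aestronglyMeasurable h))).trans ?_
  rw [← Lp.edist_def]
  exact hdist.le

theorem enorm_avg_sub_le (S : MPSystem 𝔾 X μ) (hν : AdmissibleTimes 𝔾 ν) {g m : X → ℂ}
    (hm : Measurable m) (hC : ∃ C : ℝ, ∀ x, ‖m x‖ ≤ C)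
    {n : ℕ} {x : X} (hx : IntegrableOn (fun j => g (S.T j x)) (box 𝔾 n) ν) :
    ‖S.avg ν n g x - S.avg ν n m x‖ₑ ≤
      (∫⁻ j in box 𝔾 n, ‖g (S.T j x) - m (S.T j x)‖ₑ ∂ν) / ν (box 𝔾 n) := by
  obtain ⟨C, hC⟩ := hC
  have hint : IntegrableOn (fun j => m (S.T j x)) (box 𝔾 n) ν :=
    Measure.integrableOn_of_bounded (hν.measure_box_ne_top n)
      (hm.comp (S.measurable_orbit x)).aestronglyMeasurable (ae_of_all _ fun j => hC _)
  rcases eq_or_ne (ν (box 𝔾 n)) 0 with h0 | h0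
  · simp [avg, Measure.restrict_eq_zero.2 h0]
  rw [avg, avg, setAverage_eq, setAverage_eq, ← smul_sub, ← integral_sub hx hint, enorm_smul]
  rw [ENNReal.div_eq_inv_mul]
  refine mul_le_mul' ?_ (enorm_integral_le_lintegral_enorm _)
  rw [measureReal_def, ← ENNReal.toReal_inv, Real.enorm_of_nonneg ENNReal.toReal_nonneg,
    ENNReal.ofReal_toReal (ENNReal.inv_ne_top.2 h0)]

theorem ae_integrableOn_box (S : MPSystem 𝔾 X μ) [SFinite μ] (hν : AdmissibleTimes 𝔾 ν)
    {g : X → ℂ} (hg : Measurable g) (hi : Integrable g μ) :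
    ∀ᵐ x ∂μ, ∀ n, IntegrableOn (fun j => g (S.T j x)) (box 𝔾 n) ν := by
  have := hν.sigmaFinite
  refine ae_all_iff.2 fun n => ?_
  have h := S.lintegral_lintegral_box (ν := ν) hg.enorm (box 𝔾 n)
  have hfin : ∫⁻ x, ∫⁻ j in box 𝔾 n, ‖g (S.T j x)‖ₑ ∂ν ∂μ ≠ ∞ := by
    rw [h]
    exact ENNReal.mul_ne_top (hν.measure_box_ne_top n) hi.2.ne
  filter_upwards [ae_lt_top (S.measurable_lintegral_box hg.enorm n) hfin] with x hx
  exact ⟨(hg.comp (S.measurable_orbit x)).aestronglyMeasurable, hx⟩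

/-- The mean ergodic theorem, in `L¹`, for a function that is orthogonal to the fixed vectors. -/
theorem tendsto_lintegral_avg (S : MPSystem 𝔾 X μ) [IsProbabilityMeasure μ]
    (hν : AdmissibleTimes 𝔾 ν) {G : Lp ℂ 2 μ}
    (hG : ∀ K : Lp ℂ 2 μ, (∀ j, S.koopmanIso j K = K) → inner ℂ K G = 0) :
    Tendsto (fun n => ∫⁻ x, ‖S.avg ν n G x‖ₑ ∂μ) atTop (𝓝 0) := by
  have := hν.sigmaFinite
  have hGm : Measurable G := (Lp.stronglyMeasurable G).measurable
  have hGi : Integrable G μ := (Lp.memLp G).integrable (by norm_num)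
  refine ENNReal.tendsto_atTop_zero.2 fun ε hε => ?_
  obtain ⟨m, hm, ⟨C, hC⟩, hlim, hδ⟩ :=
    S.exists_tendsto_avg_zero hν hG (δ := ε / 2) (ENNReal.half_pos hε.ne').ne'
  have hm0 : Tendsto (fun n => ∫⁻ x, ‖S.avg ν n m x‖ₑ ∂μ) atTop (𝓝 (∫⁻ _, 0 ∂μ)) := by
    refine tendsto_lintegral_of_dominated_convergence (fun _ => ENNReal.ofReal C)
      (fun n => (S.measurable_avg hm n).enorm) (fun n => ae_of_all _ fun x => ?_) (by simp)
      (ae_of_all _ fun x => by simpa using (hlim x).enorm)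
    simp only
    rw [← ofReal_norm]
    refine ENNReal.ofReal_le_ofReal ?_
    have hC0 : 0 ≤ C := (norm_nonneg _).trans (hC x)
    rw [avg, setAverage_eq, norm_smul, norm_inv, Real.norm_of_nonneg measureReal_nonneg]
    have h1 : ‖∫ j in box 𝔾 n, m (S.T j x) ∂ν‖ ≤ C * ν.real (box 𝔾 n) :=
      norm_setIntegral_le_of_norm_le_const (hν.measure_box_ne_top n).lt_top fun j _ => hC _
    rcases eq_or_ne (ν.real (box 𝔾 n)) 0 with h0 | h0
    · simpa [h0] using hC0
    · rw [inv_mul_le_iff₀ (lt_of_le_of_ne measureReal_nonneg h0.symm), mul_comm]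
      exact h1
  rw [lintegral_zero] at hm0
  obtain ⟨N, hN⟩ := ENNReal.tendsto_atTop_zero.1 hm0 (ε / 2) (ENNReal.half_pos hε.ne')
  refine ⟨max N 1, fun n hn => ?_⟩
  have hn0 : n ≠ 0 := by have := le_of_max_le_right hn; omega
  have hr : Measurable fun x => ‖G x - m x‖ₑ := (hGm.sub hm).enorm
  calc ∫⁻ x, ‖S.avg ν n G x‖ₑ ∂μ
      ≤ ∫⁻ x, (‖S.avg ν n m x‖ₑ +
          (∫⁻ j in box 𝔾 n, ‖G (S.T j x) - m (S.T j x)‖ₑ ∂ν) / ν (box 𝔾 n)) ∂μ := by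
        refine lintegral_mono_ae ?_
        filter_upwards [S.ae_integrableOn_box hν hGm hGi] with x hx
        refine le_trans ?_ (add_le_add_right (S.enorm_avg_sub_le hν hm ⟨C, hC⟩ (hx n)) _)
        simpa using enorm_add_le (S.avg ν n m x) (S.avg ν n G x - S.avg ν n m x)
    _ = ∫⁻ x, ‖S.avg ν n m x‖ₑ ∂μ + ∫⁻ x, ‖G x - m x‖ₑ ∂μ := by
        rw [lintegral_add_left (S.measurable_avg hm n).enorm]
        simp_rw [div_eq_mul_inv]
        rw [lintegral_mul_const _ (S.measurable_lintegral_box hr n),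
          S.lintegral_lintegral_box hr, mul_right_comm,
          ENNReal.mul_inv_cancel (hν.measure_box_ne_zero hn0) (hν.measure_box_ne_top n), one_mul]
    _ ≤ ε / 2 + ε / 2 := add_le_add (hN n (le_of_max_le_left hn)) hδ
    _ = ε := ENNReal.add_halves ε

/-- In an ergodic system the fixed vectors are the constants. -/
theorem IsErgodic.ae_const_of_koopmanIso {S : MPSystem 𝔾 X μ} (hS : S.IsErgodic)
    (hν : AdmissibleTimes 𝔾 ν) [IsProbabilityMeasure μ] {K : Lp ℂ 2 μ}
    (hK : ∀ j, S.koopmanIso j K = K) : ∃ c : ℂ, K =ᵐ[μ] fun _ => c := by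
  refine hS.ae_eq_const hν (Lp.stronglyMeasurable K).measurable fun j => ?_
  have h := S.coeFn_koopman j K
  rw [← koopmanIso_apply, hK j] at h
  exact h.symm

theorem IsErgodic.inner_eq_zero {S : MPSystem 𝔾 X μ} (hS : S.IsErgodic)
    (hν : AdmissibleTimes 𝔾 ν) [IsProbabilityMeasure μ] {G : Lp ℂ 2 μ} (hG : ∫ x, G x ∂μ = 0)
    {K : Lp ℂ 2 μ} (hK : ∀ j, S.koopmanIso j K = K) : inner ℂ K G = 0 := by
  obtain ⟨c, hc⟩ := hS.ae_const_of_koopmanIso hν hK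
  rw [L2.inner_def]
  have h : ∀ᵐ x ∂μ, inner ℂ (K x) (G x) = (starRingEnd ℂ c) * G x := by
    filter_upwards [hc] with x hx
    rw [hx, RCLike.inner_apply, mul_comm]
  rw [integral_congr_ae h, integral_const_mul, hG, mul_zero]

/-- Bounded functions whose averages converge everywhere to a constant are dense in `L¹`, and the
constant is close to the integral. -/
theorem IsErgodic.exists_approx {S : MPSystem 𝔾 X μ} (hS : S.IsErgodic)
    (hν : AdmissibleTimes 𝔾 ν) [IsProbabilityMeasure μ] {g : X → ℂ} (hi : Integrable g μ)
    {δ : ℝ≥0∞} (hδ : δ ≠ 0) :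
    ∃ (m : X → ℂ) (c : ℂ), Measurable m ∧ (∃ C : ℝ, ∀ x, ‖m x‖ ≤ C) ∧
      (∀ x, Tendsto (fun n => S.avg ν n m x) atTop (𝓝 c)) ∧
      ∫⁻ x, ‖g x - m x‖ₑ ∂μ ≤ δ ∧ ‖∫ x, g x ∂μ - c‖ₑ ≤ δ := by
  have hδ2 : δ / 2 ≠ 0 := (ENNReal.half_pos hδ).ne'
  obtain ⟨φ, hφ, hφ1⟩ := (memLp_one_iff_integrable.2 hi).exists_simpleFunc_eLpNorm_sub_lt
    (by norm_num) hδ2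
  rw [eLpNorm_one_eq_lintegral_enorm] at hφ
  have hφi : Integrable φ μ := memLp_one_iff_integrable.1 hφ1
  obtain ⟨C, hC⟩ := φ.exists_forall_norm_le
  set c := ∫ x, φ x ∂μ with hc
  have hmem : MemLp (fun x => φ x - c) 2 μ :=
    MemLp.of_bound (φ.measurable.sub_const c).aestronglyMeasurable (C + ‖c‖)
      (ae_of_all _ fun x => (norm_sub_le _ _).trans (add_le_add_left (hC x) _))
  have hint0 : ∫ x, hmem.toLp _ x ∂μ = 0 := by
    rw [integral_congr_ae hmem.coeFn_toLp, integral_sub hφi (integrable_const c)]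
    simp [hc]
  obtain ⟨m, hm, ⟨D, hD⟩, hlim, hle⟩ :=
    S.exists_tendsto_avg_zero hν (fun K hK => hS.inner_eq_zero hν hint0 hK) hδ2
  refine ⟨fun x => m x + c, c, hm.add_const c,
    ⟨D + ‖c‖, fun x => (norm_add_le _ _).trans (add_le_add_left (hD x) _)⟩, fun x => ?_, ?_, ?_⟩
  · have hint : ∀ n, IntegrableOn (fun j => m (S.T j x)) (box 𝔾 n) ν := fun n =>
      Measure.integrableOn_of_bounded (hν.measure_box_ne_top n)
        (hm.comp (S.measurable_orbit x)).aestronglyMeasurable (ae_of_all _ fun j => hD _)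
    have h : ∀ᶠ n in atTop, S.avg ν n m x + c = S.avg ν n (fun x => m x + c) x := by
      filter_upwards [eventually_ne_atTop 0] with n hn
      have h1 : ⨍ _ in box 𝔾 n, c ∂ν = c :=
        setAverage_const (hν.measure_box_ne_zero hn) (hν.measure_box_ne_top n) c
      rw [setAverage_eq] at h1
      rw [avg, avg, setAverage_eq, setAverage_eq, integral_add (hint n)
        (integrableOn_const (hν.measure_box_ne_top n)), smul_add, h1]
    have h2 := (hlim x).add_const c
    rw [zero_add] at h2
    exact h2.congr' h
  · have hcongr : ∫⁻ x, ‖hmem.toLp _ x - m x‖ₑ ∂μ = ∫⁻ x, ‖φ x - (m x + c)‖ₑ ∂μ := by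
      refine lintegral_congr_ae ?_
      filter_upwards [hmem.coeFn_toLp] with x hx
      rw [hx]
      congr 1
      ring
    calc ∫⁻ x, ‖g x - (m x + c)‖ₑ ∂μ
        ≤ ∫⁻ x, (‖(g - φ) x‖ₑ + ‖φ x - (m x + c)‖ₑ) ∂μ := by
          refine lintegral_mono fun x => ?_
          simpa using enorm_add_le (g x - φ x) (φ x - (m x + c))
      _ = ∫⁻ x, ‖(g - φ) x‖ₑ ∂μ + ∫⁻ x, ‖φ x - (m x + c)‖ₑ ∂μ :=
          lintegral_add_right _ (φ.measurable.sub (hm.add_const c)).enorm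
      _ ≤ δ / 2 + δ / 2 := add_le_add hφ.le (hcongr ▸ hle)
      _ = δ := ENNReal.add_halves δ
  · rw [hc, ← integral_sub hi hφi]
    exact (enorm_integral_le_lintegral_enorm _).trans (hφ.le.trans ENNReal.half_le_self)

/-- Wiener's pointwise ergodic theorem for averages over the boxes. The maximal inequality is
applied to the difference of `g` and a function whose averages converge everywhere. -/
theorem IsErgodic.ae_tendsto_avg {S : MPSystem 𝔾 X μ} (hS : S.IsErgodic)
    (hν : AdmissibleTimes 𝔾 ν) [IsProbabilityMeasure μ] {g : X → ℂ} (hg : Measurable g)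
    (hi : Integrable g μ) :
    ∀ᵐ x ∂μ, Tendsto (fun n => S.avg ν n g x) atTop (𝓝 (∫ x, g x ∂μ)) := by
  have key : ∀ α : ℝ≥0∞, α ≠ 0 → α ≠ ∞ →
      ∀ᵐ x ∂μ, ∀ᶠ n in atTop, ‖S.avg ν n g x - ∫ x, g x ∂μ‖ₑ ≤ 3 * α := by
    intro α hα hα'
    rw [ae_iff]
    -- By the maximal inequality the exceptional set has measure at most `18 ^ d * δ / α`.
    have hbound : ∀ δ : ℝ≥0∞, δ ≠ 0 → δ ≤ α →
        α * μ {x | ¬ ∀ᶠ n in atTop, ‖S.avg ν n g x - ∫ x, g x ∂μ‖ₑ ≤ 3 * α} ≤ 18 ^ d * δ := by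
      intro δ hδ hδα
      obtain ⟨m, c, hm, hC, hlim, hle, hc⟩ := hS.exists_approx hν hi hδ
      refine le_trans ?_ ((S.mul_measure_le_lintegral hν (hg.sub hm).enorm α).trans
        (mul_le_mul_right hle _))
      refine mul_le_mul_right (measure_mono_ae ?_) _
      filter_upwards [S.ae_integrableOn_box hν hg hi] with x hx hbad
      by_contra hE
      refine hbad ?_
      have h1 : ∀ᶠ n in atTop, ‖S.avg ν n m x - c‖ₑ ≤ α := by
        have h0 : Tendsto (fun n => ‖S.avg ν n m x - c‖ₑ) atTop (𝓝 0) := by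
          simpa using ((hlim x).sub_const c).enorm
        exact h0.eventually_le_const (pos_iff_ne_zero.2 hα)
      filter_upwards [h1, eventually_ne_atTop 0] with n hn hn0
      have h2 : (∫⁻ j in box 𝔾 n, ‖g (S.T j x) - m (S.T j x)‖ₑ ∂ν) / ν (box 𝔾 n) ≤ α := by
        rw [ENNReal.div_le_iff (hν.measure_box_ne_zero hn0) (hν.measure_box_ne_top n)]
        by_contra hlt
        exact hE ⟨n, hn0, (not_le.1 hlt).le⟩
      have h3 := (S.enorm_avg_sub_le hν hm hC (hx n)).trans h2
      have h4 : ‖c - ∫ x, g x ∂μ‖ₑ ≤ α := by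
        rw [← enorm_neg, neg_sub]; exact hc.trans hδα
      calc ‖S.avg ν n g x - ∫ x, g x ∂μ‖ₑ
          = ‖(S.avg ν n g x - S.avg ν n m x) + (S.avg ν n m x - c) + (c - ∫ x, g x ∂μ)‖ₑ := by
            congr 1; ring
        _ ≤ α + α + α := (enorm_add_le _ _).trans
            (add_le_add ((enorm_add_le _ _).trans (add_le_add h3 hn)) h4)
        _ = 3 * α := by ring
    have hzero : α * μ {x | ¬ ∀ᶠ n in atTop, ‖S.avg ν n g x - ∫ x, g x ∂μ‖ₑ ≤ 3 * α} = 0 := by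
      by_contra hne
      have hpos := pos_iff_ne_zero.2 hne
      have h18 : (18 : ℝ≥0∞) ^ d ≠ 0 := pow_ne_zero _ (by norm_num)
      have h18' : (18 : ℝ≥0∞) ^ d ≠ ∞ := ENNReal.pow_ne_top (by norm_num)
      set p := α * μ {x | ¬ ∀ᶠ n in atTop, ‖S.avg ν n g x - ∫ x, g x ∂μ‖ₑ ≤ 3 * α} with hp
      have hptop : p ≠ ∞ := ENNReal.mul_ne_top hα' (measure_ne_top _ _)
      have hb := hbound (min α (p / (2 * 18 ^ d)))
        (by
          rw [← pos_iff_ne_zero, lt_min_iff]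
          exact ⟨pos_iff_ne_zero.2 hα, ENNReal.div_pos hne (ENNReal.mul_ne_top (by norm_num) h18')⟩)
        (min_le_left _ _)
      have : p ≤ p / 2 := by
        refine hb.trans ((mul_le_mul_right (min_le_right _ _) _).trans_eq ?_)
        rw [div_eq_mul_inv, ENNReal.mul_inv (Or.inl (by norm_num)) (Or.inl (by norm_num)),
          mul_left_comm, mul_left_comm _ (2⁻¹ : ℝ≥0∞), ENNReal.mul_inv_cancel h18 h18', mul_one,
          div_eq_mul_inv]
      exact absurd this (not_le.2 (ENNReal.half_lt_self hne hptop))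
    exact (mul_eq_zero.1 hzero).resolve_left hα
  have hall : ∀ᵐ x ∂μ, ∀ k : ℕ, ∀ᶠ n in atTop,
      ‖S.avg ν n g x - ∫ x, g x ∂μ‖ₑ ≤ 3 * ((k : ℝ≥0∞) + 1)⁻¹ :=
    ae_all_iff.2 fun k => key _ (by simp) (by simp)
  filter_upwards [hall] with x hx
  rw [tendsto_iff_edist_tendsto_0]
  refine ENNReal.tendsto_nhds_zero.2 fun ε hε => ?_
  obtain ⟨k, hk⟩ := ENNReal.exists_inv_nat_lt (a := ε / 3)
    (ENNReal.div_pos hε.ne' (by norm_num)).ne'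
  filter_upwards [hx k] with n hn
  rw [edist_eq_enorm_sub]
  refine hn.trans ?_
  have h1 : ((k : ℝ≥0∞) + 1)⁻¹ ≤ ε / 3 :=
    (ENNReal.inv_le_inv.2 (le_add_of_nonneg_right zero_le_one)).trans hk.le
  calc 3 * ((k : ℝ≥0∞) + 1)⁻¹ ≤ 3 * (ε / 3) := mul_le_mul_right h1 _
    _ = ε := ENNReal.mul_div_cancel (by norm_num) (by norm_num)

end MPSystem

/-! ### Tensor products and integral operators -/

section Tensor

open scoped ComplexConjugate

variable {X : Type*} [MeasurableSpace X] {μ : Measure X}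

theorem memLp_tensor [SFinite μ] (g f : Lp ℂ 2 μ) :
    MemLp (fun p : X × X => g p.1 * conj (f p.2)) 2 (μ.prod μ) := by
  have hm : AEStronglyMeasurable (fun p : X × X => g p.1 * conj (f p.2)) (μ.prod μ) :=
    ((Lp.stronglyMeasurable g).comp_measurable measurable_fst).aestronglyMeasurable.mul
      (Complex.continuous_conj.comp_aestronglyMeasurable
        ((Lp.stronglyMeasurable f).comp_measurable measurable_snd).aestronglyMeasurable)
  rw [memLp_two_iff_integrable_sq_norm hm]
  have h := (Lp.memLp g).norm.integrable_sq.mul_prod (Lp.memLp f).norm.integrable_sq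
  refine h.congr (ae_of_all _ fun p => ?_)
  simp [mul_pow]

/-- The function `(x, y) ↦ g x * conj (f y)` in `L²(μ × μ)`. -/
def tensor [SFinite μ] (g f : Lp ℂ 2 μ) : Lp ℂ 2 (μ.prod μ) := (memLp_tensor g f).toLp _

theorem coeFn_tensor [SFinite μ] (g f : Lp ℂ 2 μ) :
    tensor g f =ᵐ[μ.prod μ] fun p => g p.1 * conj (f p.2) :=
  (memLp_tensor g f).coeFn_toLp

theorem ae_fst [SFinite μ] {p : X → Prop} (h : ∀ᵐ x ∂μ, p x) : ∀ᵐ q ∂μ.prod μ, p q.1 :=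
  Measure.quasiMeasurePreserving_fst.ae h

theorem ae_snd [SFinite μ] {p : X → Prop} (h : ∀ᵐ x ∂μ, p x) : ∀ᵐ q ∂μ.prod μ, p q.2 :=
  Measure.quasiMeasurePreserving_snd.ae h

variable [IsProbabilityMeasure μ]

theorem tensor_add_left (g g' f : Lp ℂ 2 μ) : tensor (g + g') f = tensor g f + tensor g' f := by
  refine Lp.ext ?_
  filter_upwards [coeFn_tensor (g + g') f, coeFn_tensor g f, coeFn_tensor g' f,
    Lp.coeFn_add (tensor g f) (tensor g' f), ae_fst (Lp.coeFn_add g g')] with p h1 h2 h3 h4 h5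
  rw [h1, h4, Pi.add_apply, h2, h3, h5, Pi.add_apply, add_mul]

theorem tensor_add_right (g f f' : Lp ℂ 2 μ) : tensor g (f + f') = tensor g f + tensor g f' := by
  refine Lp.ext ?_
  filter_upwards [coeFn_tensor g (f + f'), coeFn_tensor g f, coeFn_tensor g f',
    Lp.coeFn_add (tensor g f) (tensor g f'), ae_snd (Lp.coeFn_add f f')] with p h1 h2 h3 h4 h5
  rw [h1, h4, Pi.add_apply, h2, h3, h5, Pi.add_apply, map_add, mul_add]

theorem tensor_smul_left (c : ℂ) (g f : Lp ℂ 2 μ) : tensor (c • g) f = c • tensor g f := by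
  refine Lp.ext ?_
  filter_upwards [coeFn_tensor (c • g) f, coeFn_tensor g f,
    Lp.coeFn_smul c (tensor g f), ae_fst (Lp.coeFn_smul c g)] with p h1 h2 h3 h4
  rw [h1, h3, Pi.smul_apply, h2, h4, Pi.smul_apply, smul_mul_assoc]

theorem tensor_smul_right (c : ℂ) (g f : Lp ℂ 2 μ) :
    tensor g (c • f) = conj c • tensor g f := by
  refine Lp.ext ?_
  filter_upwards [coeFn_tensor g (c • f), coeFn_tensor g f,
    Lp.coeFn_smul (conj c) (tensor g f), ae_snd (Lp.coeFn_smul c f)] with p h1 h2 h3 h4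
  rw [h1, h3, Pi.smul_apply, h2, h4, Pi.smul_apply]
  simp only [smul_eq_mul, map_mul]
  ring

theorem inner_tensor (g f a b : Lp ℂ 2 μ) :
    inner ℂ (tensor g f) (tensor a b) = inner ℂ g a * inner ℂ b f := by
  rw [L2.inner_def, L2.inner_def, L2.inner_def, ← integral_prod_mul]
  refine integral_congr_ae ?_
  filter_upwards [coeFn_tensor g f, coeFn_tensor a b] with p h1 h2
  rw [h1, h2]
  simp only [RCLike.inner_apply, map_mul, Complex.conj_conj]
  ring

theorem norm_tensor (g f : Lp ℂ 2 μ) : ‖tensor g f‖ = ‖g‖ * ‖f‖ := by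
  have h := inner_tensor g f g f
  rw [inner_self_eq_norm_sq_to_K, inner_self_eq_norm_sq_to_K, inner_self_eq_norm_sq_to_K,
    ← mul_pow] at h
  have h' : ‖tensor g f‖ ^ 2 = (‖g‖ * ‖f‖) ^ 2 := by exact_mod_cast h
  exact (pow_left_inj₀ (norm_nonneg _) (by positivity) two_ne_zero).1 h'

theorem inner_tensor_indicator {A B : Set X} (hA : MeasurableSet A) (hB : MeasurableSet B)
    (K : Lp ℂ 2 (μ.prod μ)) :
    inner ℂ (tensor (indicatorConstLp 2 hA (measure_ne_top μ A) (1 : ℂ))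
      (indicatorConstLp 2 hB (measure_ne_top μ B) (1 : ℂ))) K = ∫ p in A ×ˢ B, K p ∂μ.prod μ := by
  rw [L2.inner_def, ← integral_indicator (hA.prod hB)]
  refine integral_congr_ae ?_
  filter_upwards [coeFn_tensor (indicatorConstLp 2 hA (measure_ne_top μ A) (1 : ℂ))
      (indicatorConstLp 2 hB (measure_ne_top μ B) (1 : ℂ)),
    ae_fst (indicatorConstLp_coeFn (μ := μ) (p := 2) (hs := hA) (hμs := measure_ne_top μ A)
      (c := (1 : ℂ))),
    ae_snd (indicatorConstLp_coeFn (μ := μ) (p := 2) (hs := hB) (hμs := measure_ne_top μ B)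
      (c := (1 : ℂ)))] with p h1 h2 h3
  rw [h1, h2, h3]
  by_cases hpA : p.1 ∈ A <;> by_cases hpB : p.2 ∈ B <;> simp [indicator, hpA, hpB]

/-- A function on `X × X` that is orthogonal to all products is `0`, because its integral over
every rectangle is `0`. -/
theorem eq_zero_of_inner_tensor {K : Lp ℂ 2 (μ.prod μ)}
    (h : ∀ g f : Lp ℂ 2 μ, inner ℂ (tensor g f) K = 0) : K = 0 := by
  have hi : Integrable K (μ.prod μ) := (Lp.memLp K).integrable (by norm_num)
  have hrect : ∀ A B : Set X, MeasurableSet A → MeasurableSet B →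
      ∫ p in A ×ˢ B, K p ∂μ.prod μ = 0 := fun A B hA hB => by
    rw [← inner_tensor_indicator hA hB, h]
  have huniv : ∫ p, K p ∂μ.prod μ = 0 := by
    rw [← hrect univ univ .univ .univ, univ_prod_univ, setIntegral_univ]
  have hall : ∀ s : Set (X × X), MeasurableSet s → ∫ p in s, K p ∂μ.prod μ = 0 := by
    refine MeasurableSpace.induction_on_inter generateFrom_prod.symm isPiSystem_prod (by simp)
      ?_ ?_ ?_
    · rintro _ ⟨A, hA, B, hB, rfl⟩
      exact hrect A B hA hB
    · intro s hs h0
      rw [setIntegral_compl hs hi, h0, huniv, sub_zero]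
    · intro s hd hs h0
      rw [integral_iUnion hs hd hi.integrableOn]
      simp [h0]
  exact Lp.eq_zero_iff_ae_eq_zero.2
    (hi.ae_eq_zero_of_forall_setIntegral_eq_zero fun s hs _ => hall s hs)

theorem dense_span_tensor :
    Dense (Submodule.span ℂ (range fun q : Lp ℂ 2 μ × Lp ℂ 2 μ => tensor q.1 q.2) :
      Set (Lp ℂ 2 (μ.prod μ))) := by
  rw [Submodule.dense_iff_topologicalClosure_eq_top, Submodule.topologicalClosure_eq_top_iff,
    Submodule.eq_bot_iff]
  intro K hK
  refine eq_zero_of_inner_tensor fun g f => ?_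
  exact (Submodule.mem_orthogonal _ _).1 hK _ (Submodule.subset_span ⟨(g, f), rfl⟩)

/-- The sesquilinear form of the integral operator with kernel `K`. -/
def kernelForm (K : Lp ℂ 2 (μ.prod μ)) : Lp ℂ 2 μ →L⋆[ℂ] Lp ℂ 2 μ →L[ℂ] ℂ :=
  LinearMap.mkContinuous₂
    (LinearMap.mk₂'ₛₗ (starRingEnd ℂ) (RingHom.id ℂ) (fun f g => inner ℂ K (tensor g f))
      (fun f f' g => by rw [tensor_add_right, inner_add_right])
      (fun c f g => by rw [tensor_smul_right, inner_smul_right, smul_eq_mul])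
      (fun f g g' => by rw [tensor_add_left, inner_add_right])
      (fun c f g => by rw [tensor_smul_left, inner_smul_right, RingHom.id_apply, smul_eq_mul]))
    ‖K‖ (fun f g => by
      refine (norm_inner_le_norm (𝕜 := ℂ) K (tensor g f)).trans_eq ?_
      rw [norm_tensor]
      ring)

/-- The integral operator `f ↦ ∫ K(·, y) f(y) dμ(y)` on `L²(μ)` with a kernel `K` in `L²(μ × μ)`,
defined through its sesquilinear form. -/
def kernelOp (K : Lp ℂ 2 (μ.prod μ)) : Lp ℂ 2 μ →L[ℂ] Lp ℂ 2 μ :=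
  InnerProductSpace.continuousLinearMapOfBilin (kernelForm K)

theorem inner_kernelOp (K : Lp ℂ 2 (μ.prod μ)) (f g : Lp ℂ 2 μ) :
    inner ℂ (kernelOp K f) g = inner ℂ K (tensor g f) :=
  InnerProductSpace.continuousLinearMapOfBilin_apply (kernelForm K) f g

theorem norm_kernelOp_le (K : Lp ℂ 2 (μ.prod μ)) : ‖kernelOp K‖ ≤ ‖K‖ := by
  refine ContinuousLinearMap.opNorm_le_bound _ (norm_nonneg _) fun f => ?_
  have h : ‖kernelOp K f‖ * ‖kernelOp K f‖ ≤ ‖K‖ * ‖f‖ * ‖kernelOp K f‖ := by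
    have h0 : ‖kernelOp K f‖ * ‖kernelOp K f‖ = ‖inner ℂ (kernelOp K f) (kernelOp K f)‖ := by
      rw [inner_self_eq_norm_sq_to_K, norm_pow, RCLike.norm_ofReal, abs_norm, sq]
    rw [h0, inner_kernelOp]
    refine (norm_inner_le_norm _ _).trans_eq ?_
    rw [norm_tensor]
    ring
  rcases eq_or_ne ‖kernelOp K f‖ 0 with h0 | h0
  · rw [h0]; positivity
  · exact le_of_mul_le_mul_right h (lt_of_le_of_ne (norm_nonneg _) h0.symm)

/-- The integral operator depends linearly and continuously on its kernel. -/
def kernelOpL : Lp ℂ 2 (μ.prod μ) →L[ℂ] Lp ℂ 2 μ →L[ℂ] Lp ℂ 2 μ :=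
  LinearMap.mkContinuous
    { toFun := kernelOp
      map_add' := fun K K' => ContinuousLinearMap.ext fun f => ext_inner_right ℂ fun g => by
        rw [add_apply, inner_add_left, inner_kernelOp, inner_kernelOp,
          inner_kernelOp, inner_add_left]
      map_smul' := fun c K => ContinuousLinearMap.ext fun f => ext_inner_right ℂ fun g => by
        rw [RingHom.id_apply, smul_apply, inner_smul_left, inner_kernelOp,
          inner_kernelOp, inner_smul_left] }
    1 fun K => by rw [one_mul]; exact norm_kernelOp_le K

/-- Integral operators with square integrable kernels are limits of operators of finite rank. -/
theorem isCompactOperator_kernelOp (K : Lp ℂ 2 (μ.prod μ)) : IsCompactOperator (kernelOp K) := by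
  have hK : K ∈ closure (Submodule.span ℂ
      (range fun q : Lp ℂ 2 μ × Lp ℂ 2 μ => tensor q.1 q.2) : Set (Lp ℂ 2 (μ.prod μ))) :=
    dense_span_tensor K
  refine closure_minimal (t := {K | IsCompactOperator (kernelOpL K)}) ?_
    (isClosed_setOfPred_isCompactOperator.preimage kernelOpL.continuous) hK
  intro K hK
  refine Submodule.span_induction (p := fun K _ => IsCompactOperator (kernelOpL K)) ?_ ?_ ?_ ?_ hK
  · rintro _ ⟨⟨a, b⟩, rfl⟩
    have h : kernelOpL (tensor a b) =
        (ContinuousLinearMap.toSpanSingleton ℂ a).comp (innerSL ℂ b) := by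
      refine ContinuousLinearMap.ext fun f => ext_inner_right ℂ fun g => ?_
      refine (inner_kernelOp _ f g).trans ?_
      rw [inner_tensor]
      simp [inner_smul_left, mul_comm]
    rw [h]
    exact (isCompactOperator_of_locallyCompactSpace_rng
      (ContinuousLinearMap.toSpanSingleton ℂ a)).comp_clm _
  · rw [map_zero]
    exact isCompactOperator_zero
  · intro K K' _ _ h h'
    rw [map_add]
    exact h.add h'
  · intro c K _ h
    rw [map_smul]
    exact h.smul c

end Tensor

namespace MPSystem

open scoped ComplexConjugate
open ContinuousLinearMap (adjoint)

variable {d : ℕ} {𝔾 : AddSubmonoid (Fin d → ℝ)} {X : Type*} [MeasurableSpace X]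
  {μ : Measure X}

/-- The Koopman operator as a continuous linear map. -/
def koopmanL (S : MPSystem 𝔾 X μ) (j : 𝔾) : Lp ℂ 2 μ →L[ℂ] Lp ℂ 2 μ :=
  (S.koopmanIso j).toContinuousLinearMap

theorem inner_koopmanL (S : MPSystem 𝔾 X μ) (j : 𝔾) (g f : Lp ℂ 2 μ) :
    inner ℂ (S.koopmanL j g) (S.koopmanL j f) = inner ℂ g f :=
  (S.koopmanIso j).inner_map_map g f

variable [IsProbabilityMeasure μ]

theorem koopmanIso_tensor (S : MPSystem 𝔾 X μ) (j : 𝔾) (g f : Lp ℂ 2 μ) :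
    S.selfProd.koopmanIso j (tensor g f) = tensor (S.koopmanL j g) (S.koopmanL j f) := by
  refine Lp.ext ?_
  have h := (S.selfProd.measurePreserving j).quasiMeasurePreserving.ae (coeFn_tensor g f)
  filter_upwards [S.selfProd.coeFn_koopman j (tensor g f), h,
    coeFn_tensor (S.koopmanL j g) (S.koopmanL j f), ae_fst (S.coeFn_koopman j g),
    ae_snd (S.coeFn_koopman j f)] with p h1 h2 h3 h4 h5
  have h4' : (S.koopmanL j g) p.1 = g (S.T j p.1) := h4
  have h5' : (S.koopmanL j f) p.2 = f (S.T j p.2) := h5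
  rw [koopmanIso_apply, h1, h2, h3, h4', h5']
  rfl

theorem inner_koopmanIso_tensor_right (S : MPSystem 𝔾 X μ) (j : 𝔾) (g f : Lp ℂ 2 μ)
    (K : Lp ℂ 2 (μ.prod μ)) :
    inner ℂ (tensor g (S.koopmanL j f)) (S.selfProd.koopmanIso j K)
      = inner ℂ (tensor (adjoint (S.koopmanL j) g) f) K := by
  have h : (innerSL ℂ (tensor g (S.koopmanL j f))).comp (S.selfProd.koopmanL j)
      = innerSL ℂ (tensor (adjoint (S.koopmanL j) g) f) := by
    refine ContinuousLinearMap.ext_on dense_span_tensor ?_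
    rintro _ ⟨⟨a, b⟩, rfl⟩
    change inner ℂ (tensor g (S.koopmanL j f)) (S.selfProd.koopmanIso j (tensor a b))
      = inner ℂ (tensor (adjoint (S.koopmanL j) g) f) (tensor a b)
    rw [koopmanIso_tensor, inner_tensor, inner_tensor, ContinuousLinearMap.adjoint_inner_left,
      inner_koopmanL]
  exact DFunLike.congr_fun h K

theorem inner_koopmanIso_tensor_left (S : MPSystem 𝔾 X μ) (j : 𝔾) (g f : Lp ℂ 2 μ)
    (K : Lp ℂ 2 (μ.prod μ)) :
    inner ℂ (tensor (S.koopmanL j g) f) (S.selfProd.koopmanIso j K)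
      = inner ℂ (tensor g (adjoint (S.koopmanL j) f)) K := by
  have h : (innerSL ℂ (tensor (S.koopmanL j g) f)).comp (S.selfProd.koopmanL j)
      = innerSL ℂ (tensor g (adjoint (S.koopmanL j) f)) := by
    refine ContinuousLinearMap.ext_on dense_span_tensor ?_
    rintro _ ⟨⟨a, b⟩, rfl⟩
    change inner ℂ (tensor (S.koopmanL j g) f) (S.selfProd.koopmanIso j (tensor a b))
      = inner ℂ (tensor g (adjoint (S.koopmanL j) f)) (tensor a b)
    rw [koopmanIso_tensor, inner_tensor, inner_tensor, ContinuousLinearMap.adjoint_inner_right,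
      inner_koopmanL]
  exact DFunLike.congr_fun h K

/-- An integral operator with an invariant kernel commutes with the Koopman operators. These
need not be invertible, so that one cannot move them from one factor to the other; instead
`inner_koopmanIso_tensor_right` is used, which holds for all kernels as it holds for products. -/
theorem kernelOp_koopmanL (S : MPSystem 𝔾 X μ) {K : Lp ℂ 2 (μ.prod μ)}
    (hK : ∀ j, S.selfProd.koopmanIso j K = K) (j : 𝔾) (f : Lp ℂ 2 μ) :
    kernelOp K (S.koopmanL j f) = S.koopmanL j (kernelOp K f) := by
  refine ext_inner_right ℂ fun g => ?_
  have h := S.inner_koopmanIso_tensor_right j g f K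
  rw [hK j] at h
  rw [inner_kernelOp, ← inner_conj_symm, h, inner_conj_symm, ← inner_kernelOp,
    ContinuousLinearMap.adjoint_inner_right]

theorem adjoint_kernelOp_koopmanL (S : MPSystem 𝔾 X μ) {K : Lp ℂ 2 (μ.prod μ)}
    (hK : ∀ j, S.selfProd.koopmanIso j K = K) (j : 𝔾) (f : Lp ℂ 2 μ) :
    adjoint (kernelOp K) (S.koopmanL j f) = S.koopmanL j (adjoint (kernelOp K) f) := by
  refine ext_inner_right ℂ fun g => ?_
  have h := S.inner_koopmanIso_tensor_left j f g K
  rw [hK j] at h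
  rw [ContinuousLinearMap.adjoint_inner_left, ← inner_conj_symm, inner_kernelOp, inner_conj_symm,
    h, ← inner_conj_symm, ← inner_kernelOp, inner_conj_symm,
    ← ContinuousLinearMap.adjoint_inner_left, ContinuousLinearMap.adjoint_inner_right]

end MPSystem

/-! ### Characters of the sets of times -/

section Characters

/-- The standard character `t ↦ exp (2 π i t)` of `ℝ`. -/
def expChar (t : ℝ) : ℂ := Complex.exp (2 * Real.pi * Complex.I * (t : ℂ))

theorem expChar_add (s t : ℝ) : expChar (s + t) = expChar s * expChar t := by
  rw [expChar, expChar, expChar, ← Complex.exp_add]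
  push_cast
  ring_nf

theorem expChar_zero : expChar 0 = 1 := by simp [expChar]

theorem expChar_ne_zero (t : ℝ) : expChar t ≠ 0 := Complex.exp_ne_zero _

theorem norm_expChar (t : ℝ) : ‖expChar t‖ = 1 := by
  rw [expChar, Complex.norm_exp]
  simp

/-- A measurable unitary character of `ℝ` is differentiable, because a translation multiplies its
primitive function by a scalar, up to a constant; hence it is an exponential function. -/
theorem exists_expChar_of_measurable {C : ℝ → ℂ} (hm : Measurable C)
    (hadd : ∀ s t, C (s + t) = C s * C t) (hn : ∀ t, ‖C t‖ = 1) :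
    ∃ w : ℝ, ∀ t, C t = expChar (w * t) := by
  have hne : ∀ t, C t ≠ 0 := fun t h => by simpa [h] using hn t
  have h0 : C 0 = 1 := by
    have := hadd 0 0
    rw [add_zero] at this
    exact (mul_eq_left₀ (hne 0)).1 this.symm
  have hloc : LocallyIntegrable C volume := by
    refine (locallyIntegrable_const (1 : ℝ)).mono hm.aestronglyMeasurable
      (ae_of_all _ fun t => ?_)
    rw [hn t, norm_one]
  have hint : ∀ a b, IntervalIntegrable C volume a b := fun a b =>
    (hloc.integrableOn_isCompact isCompact_uIcc).intervalIntegrable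
  set F : ℝ → ℂ := fun x => ∫ t in (0 : ℝ)..x, C t with hF
  have hshift : ∀ t h, F (t + h) = F t + C t * F h := by
    intro t h
    have h1 := intervalIntegral.integral_comp_add_left (a := 0) (b := h) C t
    simp_rw [hadd t] at h1
    rw [intervalIntegral.integral_const_mul, add_zero] at h1
    simp only [hF]
    rw [h1, intervalIntegral.integral_add_adjacent_intervals (hint _ _) (hint _ _)]
  have hF0 : HasDerivAt F 1 0 := by
    obtain ⟨t, ht⟩ := (LocallyIntegrable.ae_hasDerivAt_integral hloc).exists
    have h1 : HasDerivAt (fun h => F (t + h)) (C t) 0 := by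
      have := ht 0
      rw [← add_zero t] at this
      simpa using this.comp_const_add t 0
    have h2 : F = fun h => (C t)⁻¹ * (F (t + h) - F t) := by
      funext h
      rw [hshift, add_sub_cancel_left, inv_mul_cancel_left₀ (hne t)]
    rw [h2]
    have h3 := (h1.sub_const (F t)).const_mul (C t)⁻¹
    rwa [inv_mul_cancel₀ (hne t)] at h3
  have hFd : ∀ t, HasDerivAt F (C t) t := by
    intro t
    have h1 : HasDerivAt (fun x => F t + C t * F (x - t)) (C t * 1) t := by
      have h2 : HasDerivAt (fun x => F (x - t)) 1 t := by
        have h3 := hF0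
        rw [← sub_self t] at h3
        exact h3.comp_sub_const t t
      exact (h2.const_mul (C t)).const_add (F t)
    rw [mul_one] at h1
    refine h1.congr_of_eventuallyEq (Eventually.of_forall fun x => ?_)
    simp only
    rw [← hshift]
    congr 1
    ring
  -- Division by some `F h ≠ 0` expresses `C` by differences of `F`, so that `C` is differentiable.
  obtain ⟨h, hh⟩ : ∃ h, F h ≠ 0 := by
    by_contra hcon
    push Not at hcon
    have hz : F = fun _ => 0 := funext hcon
    rw [hz] at hF0
    exact one_ne_zero (hF0.unique (hasDerivAt_const _ _))
  have hC : ∃ κ : ℂ, HasDerivAt C κ 0 := by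
    have hCF : C = fun t => (F (t + h) - F t) / F h := by
      funext t
      rw [hshift, add_sub_cancel_left, mul_div_cancel_right₀ _ hh]
    rw [hCF]
    exact ⟨_, (((hFd (0 + h)).comp_add_const 0 h).sub (hFd 0)).div_const _⟩
  obtain ⟨κ, hκ⟩ := hC
  have hCd : ∀ t, HasDerivAt C (C t * κ) t := by
    intro t
    have h2 : HasDerivAt (fun x => C (x - t)) κ t := by
      have h3 := hκ
      rw [← sub_self t] at h3
      exact h3.comp_sub_const t t
    refine (h2.const_mul (C t)).congr_of_eventuallyEq (Eventually.of_forall fun x => ?_)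
    simp only
    rw [← hadd]
    congr 1
    ring
  have hexp : ∀ t : ℝ, C t = Complex.exp (κ * t) := by
    set g : ℝ → ℂ := fun t => C t * Complex.exp (-(κ * t)) with hg
    have hgd : ∀ t, HasDerivAt g 0 t := by
      intro t
      have h1 : HasDerivAt (fun t : ℝ => -(κ * (t : ℂ))) (-κ) t := by
        have h0 := (Complex.ofRealCLM.hasDerivAt (x := t)).const_mul κ
        rw [Complex.ofRealCLM_apply, Complex.ofReal_one, mul_one] at h0
        exact h0.neg
      have h2 := (hCd t).mul h1.cexp
      convert! h2 using 1
      ring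
    have hconst : ∀ t, g t = g 0 := fun t =>
      is_const_of_deriv_eq_zero (fun t => (hgd t).differentiableAt) (fun t => (hgd t).deriv) t 0
    intro t
    have h1 := hconst t
    simp only [hg, h0, Complex.ofReal_zero, mul_zero, neg_zero, Complex.exp_zero, mul_one] at h1
    rw [Complex.exp_neg] at h1
    rwa [mul_inv_eq_one₀ (Complex.exp_ne_zero _)] at h1
  have hre : κ.re = 0 := by
    have h1 := hn 1
    rw [hexp, Complex.norm_exp] at h1
    simpa using h1
  refine ⟨κ.im / (2 * Real.pi), fun t => ?_⟩
  rw [hexp, expChar]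
  congr 1
  have hκ' : κ = κ.im * Complex.I := by
    apply Complex.ext <;> simp [hre]
  have hpi : (Real.pi : ℂ) ≠ 0 := Complex.ofReal_ne_zero.2 Real.pi_ne_zero
  conv_lhs => rw [hκ']
  push_cast
  field_simp

/-- A measurable unitary character of the half-line extends to one of `ℝ`, by
`p - q ↦ c p / c q`. -/
theorem exists_expChar_of_measurable_nonneg {c : ℝ → ℂ} (hm : Measurable c)
    (hadd : ∀ s t, 0 ≤ s → 0 ≤ t → c (s + t) = c s * c t) (hn : ∀ t, 0 ≤ t → ‖c t‖ = 1) :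
    ∃ w : ℝ, ∀ t, 0 ≤ t → c t = expChar (w * t) := by
  have hne : ∀ t, 0 ≤ t → c t ≠ 0 := fun t ht h => by simpa [h] using hn t ht
  set C : ℝ → ℂ := fun t => c (t + |t|) / c |t| with hC
  have hpos : ∀ t : ℝ, 0 ≤ t + |t| := fun t => by linarith [neg_abs_le t]
  have hquot : ∀ p q, 0 ≤ p → 0 ≤ q → C (p - q) = c p / c q := by
    intro p q hp hq
    rw [hC]
    simp only
    rw [div_eq_div_iff (hne _ (abs_nonneg _)) (hne q hq), ← hadd _ _ (hpos _) hq,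
      ← hadd _ _ hp (abs_nonneg _)]
    congr 1
    ring
  obtain ⟨w, hw⟩ := exists_expChar_of_measurable (C := C)
    ((hm.comp (measurable_id.add measurable_id.abs)).div (hm.comp measurable_id.abs))
    (fun s t => by
      have h1 : s + t = (s + |s| + (t + |t|)) - (|s| + |t|) := by ring
      rw [h1, hquot _ _ (add_nonneg (hpos s) (hpos t)) (by positivity),
        hadd _ _ (hpos s) (hpos t), hadd _ _ (abs_nonneg s) (abs_nonneg t), mul_div_mul_comm])
    (fun t => by
      simp only [hC]
      rw [norm_div, hn _ (hpos t), hn _ (abs_nonneg t), div_one])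
  refine ⟨w, fun t ht => ?_⟩
  have h1 := hquot (t + 0) 0 (by simpa using ht) le_rfl
  rw [hadd t 0 ht le_rfl, mul_div_cancel_right₀ _ (hne 0 le_rfl)] at h1
  rw [← h1, hw]
  congr 1
  ring

variable {d : ℕ} {𝔾 : AddSubmonoid (Fin d → ℝ)} {ν : Measure 𝔾}

/-- A character of `𝔾` is determined by its values on the coordinate half-axes: these generate the
times with nonnegative coordinates, and every time is a difference of two such times. -/
theorem exists_frequency_of_axes
    (hsingle : ∀ p ∈ 𝔾, (∀ k, 0 ≤ p k) → ∀ k, Pi.single k (p k) ∈ 𝔾)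
    (habs : ∀ j ∈ 𝔾, ∃ q ∈ 𝔾, (∀ k, 0 ≤ q k) ∧ ∀ k, 0 ≤ (j + q) k) {χ : 𝔾 → ℂ}
    (hadd : ∀ i j, χ (i + j) = χ i * χ j) (hn : ∀ j, ‖χ j‖ = 1)
    (hax : ∀ k, ∃ w : ℝ, ∀ (t : ℝ) (ht : Pi.single k t ∈ 𝔾), 0 ≤ t →
      χ ⟨Pi.single k t, ht⟩ = expChar (w * t)) :
    ∃ w : Fin d → ℝ, ∀ j : 𝔾, χ j = expChar (∑ k, w k * (j : Fin d → ℝ) k) := by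
  choose w hw using hax
  refine ⟨w, ?_⟩
  have hne : ∀ j, χ j ≠ 0 := fun j h => by simpa [h] using hn j
  have hχ0 : χ 0 = 1 := by
    have := hadd 0 0
    rw [add_zero] at this
    exact (mul_eq_left₀ (hne 0)).1 this.symm
  set e : 𝔾 → ℂ := fun j => expChar (∑ k, w k * (j : Fin d → ℝ) k) with he
  have headd : ∀ i j, e (i + j) = e i * e j := by
    intro i j
    simp only [he, AddSubmonoid.coe_add, Pi.add_apply, mul_add, Finset.sum_add_distrib, expChar_add]
  let D : AddSubmonoid 𝔾 :=
    { carrier := {j | χ j = e j}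
      zero_mem' := by simp [hχ0, he, expChar_zero]
      add_mem' := fun {a b} ha hb => by
        change χ (a + b) = e (a + b)
        rw [hadd, headd, show χ a = e a from ha, show χ b = e b from hb] }
  have hpos : ∀ p : 𝔾, (∀ k, 0 ≤ (p : Fin d → ℝ) k) → χ p = e p := by
    intro p hp
    have hsum : p = ∑ k, (⟨Pi.single k ((p : Fin d → ℝ) k), hsingle p p.2 hp k⟩ : 𝔾) := by
      refine Subtype.ext ?_
      rw [AddSubmonoid.coe_finsetSum]
      exact (Finset.univ_sum_single _).symm
    have hmem : p ∈ D := by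
      rw [hsum]
      refine sum_mem fun k _ => ?_
      change χ _ = e _
      rw [hw k _ _ (hp k)]
      simp only [he]
      congr 1
      rw [Finset.sum_eq_single k]
      · simp
      · intro l _ hl
        simp [Pi.single_eq_of_ne hl]
      · simp
    exact hmem
  intro j
  obtain ⟨q, hq, hq0, hjq⟩ := habs j j.2
  have h1 := hpos (j + ⟨q, hq⟩) hjq
  rw [hadd, headd, hpos ⟨q, hq⟩ hq0] at h1
  exact mul_right_cancel₀ (expChar_ne_zero _) h1

theorem exists_axis_frequency_of_lattice (h1 : natLattice d ≤ 𝔾) (h2 : 𝔾 ≤ intLattice d)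
    {χ : 𝔾 → ℂ} (hadd : ∀ i j, χ (i + j) = χ i * χ j) (hn : ∀ j, ‖χ j‖ = 1) (k : Fin d) :
    ∃ w : ℝ, ∀ (t : ℝ) (ht : Pi.single k t ∈ 𝔾), 0 ≤ t →
      χ ⟨Pi.single k t, ht⟩ = expChar (w * t) := by
  have hmem : ∀ m : ℕ, (Pi.single k (m : ℝ) : Fin d → ℝ) ∈ 𝔾 := fun m => h1 fun l => by
    rcases eq_or_ne l k with rfl | hl
    · exact ⟨m, by simp⟩
    · exact ⟨0, by simp [Pi.single_eq_of_ne hl]⟩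
  have hne : ∀ j, χ j ≠ 0 := fun j h => by simpa [h] using hn j
  have hχ0 : χ 0 = 1 := by
    have := hadd 0 0
    rw [add_zero] at this
    exact (mul_eq_left₀ (hne 0)).1 this.symm
  set a := χ ⟨_, hmem 1⟩ with ha
  set w : ℝ := a.arg / (2 * Real.pi) with hw
  have haw : a = expChar w := by
    have h := Complex.norm_mul_exp_arg_mul_I a
    rw [hn, Complex.ofReal_one, one_mul] at h
    rw [expChar, hw]; conv_lhs => rw [← h]
    congr 1
    have hpi : (Real.pi : ℂ) ≠ 0 := Complex.ofReal_ne_zero.2 Real.pi_ne_zero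
    push_cast
    field_simp
  have hnat : ∀ m : ℕ, χ ⟨_, hmem m⟩ = expChar (w * m) := by
    intro m
    induction m with
    | zero =>
      have : (⟨_, hmem 0⟩ : 𝔾) = 0 := Subtype.ext (by simp)
      rw [this, hχ0]
      simp [expChar_zero]
    | succ m ih =>
      have : (⟨_, hmem (m + 1)⟩ : 𝔾) = ⟨_, hmem m⟩ + ⟨_, hmem 1⟩ := Subtype.ext (by
        simp [← Pi.single_add])
      rw [this, hadd, ih, ← ha, haw, ← expChar_add]
      congr 1
      push_cast
      ring
  refine ⟨w, fun t ht h0 => ?_⟩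
  obtain ⟨m, hm⟩ := h2 ht k
  rw [Pi.single_eq_same] at hm
  obtain ⟨n, rfl⟩ : ∃ n : ℕ, t = n := by
    have : 0 ≤ m := by exact_mod_cast hm ▸ h0
    exact ⟨m.toNat, by rw [hm]; exact_mod_cast (Int.toNat_of_nonneg this).symm⟩
  exact hnat n

theorem exists_axis_frequency_of_real (h1 : posOrthant d ≤ 𝔾) {χ : 𝔾 → ℂ} (hm : Measurable χ)
    (hadd : ∀ i j, χ (i + j) = χ i * χ j) (hn : ∀ j, ‖χ j‖ = 1) (k : Fin d) :
    ∃ w : ℝ, ∀ (t : ℝ) (ht : Pi.single k t ∈ 𝔾), 0 ≤ t →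
      χ ⟨Pi.single k t, ht⟩ = expChar (w * t) := by
  have hmem : ∀ t : ℝ, (Pi.single k (max t 0) : Fin d → ℝ) ∈ 𝔾 := fun t => h1 fun l => by
    rcases eq_or_ne l k with rfl | hl
    · simp
    · simp [Pi.single_eq_of_ne hl]
  have hmeas : Measurable fun t : ℝ => (⟨_, hmem t⟩ : 𝔾) := by
    refine Measurable.subtype_mk (measurable_pi_iff.2 fun l => ?_)
    rcases eq_or_ne l k with rfl | hl
    · simpa using measurable_id.max measurable_const
    · simp [Pi.single_eq_of_ne hl]
  obtain ⟨w, hw⟩ := exists_expChar_of_measurable_nonneg (c := fun t => χ ⟨_, hmem t⟩)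
    (hm.comp hmeas) (fun s t hs ht => by
      rw [← hadd]
      congr 1
      refine Subtype.ext ?_
      simp [max_eq_left hs, max_eq_left ht, max_eq_left (add_nonneg hs ht), ← Pi.single_add])
    (fun t _ => hn _)
  refine ⟨w, fun t ht h0 => ?_⟩
  rw [← hw t h0]
  congr 2
  rw [max_eq_left h0]

theorem exists_nonneg_add_nonneg_of_abs_mem {j : Fin d → ℝ} (hj : (fun k => |j k|) ∈ 𝔾) :
    ∃ q ∈ 𝔾, (∀ k, 0 ≤ q k) ∧ ∀ k, 0 ≤ (j + q) k :=
  ⟨_, hj, fun _ => abs_nonneg _, fun k => by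
    simp only [Pi.add_apply]; linarith [neg_abs_le (j k)]⟩

theorem natLattice_single {p : Fin d → ℝ} (hp : p ∈ intLattice d) (h0 : ∀ k, 0 ≤ p k)
    (k : Fin d) : Pi.single k (p k) ∈ natLattice d := by
  intro l
  rcases eq_or_ne l k with rfl | hl
  · obtain ⟨m, hm⟩ := hp l
    have : 0 ≤ m := by exact_mod_cast hm ▸ h0 l
    exact ⟨m.toNat, by rw [Pi.single_eq_same, hm]; exact_mod_cast (Int.toNat_of_nonneg this).symm⟩
  · exact ⟨0, by simp [Pi.single_eq_of_ne hl]⟩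

theorem posOrthant_single {p : Fin d → ℝ} (h0 : ∀ k, 0 ≤ p k) (k : Fin d) :
    Pi.single k (p k) ∈ posOrthant d := by
  intro l
  rcases eq_or_ne l k with rfl | hl
  · simpa using h0 l
  · simp [Pi.single_eq_of_ne hl]

/-- The measurable unitary characters of `𝔾` are the exponentials `j ↦ exp (2 π i ⟨w, j⟩)`. -/
theorem IsTimes.exists_frequency (h : IsTimes d 𝔾 ν) {χ : 𝔾 → ℂ} (hm : Measurable χ)
    (hadd : ∀ i j, χ (i + j) = χ i * χ j) (hn : ∀ j, ‖χ j‖ = 1) :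
    ∃ w : Fin d → ℝ, ∀ j : 𝔾, χ j = expChar (∑ k, w k * (j : Fin d → ℝ) k) := by
  cases h with
  | int =>
    refine exists_frequency_of_axes
      (fun p hp h0 k => natLattice_le_intLattice d (natLattice_single hp h0 k))
      (fun j hj => exists_nonneg_add_nonneg_of_abs_mem fun k => ?_) hadd hn
      (exists_axis_frequency_of_lattice (natLattice_le_intLattice d) le_rfl hadd hn)
    obtain ⟨m, hm⟩ := hj k
    exact ⟨|m|, by simp [hm]⟩
  | nat =>
    refine exists_frequency_of_axes
      (fun p hp h0 k => natLattice_single (natLattice_le_intLattice d hp) h0 k)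
      (fun j hj => exists_nonneg_add_nonneg_of_abs_mem fun k => ?_) hadd hn
      (exists_axis_frequency_of_lattice le_rfl (natLattice_le_intLattice d) hadd hn)
    obtain ⟨m, hm⟩ := hj k
    exact ⟨m, by simp [hm]⟩
  | real =>
    exact exists_frequency_of_axes (fun _ _ _ _ => AddSubmonoid.mem_top _)
      (fun j _ => exists_nonneg_add_nonneg_of_abs_mem (AddSubmonoid.mem_top _)) hadd hn
      (exists_axis_frequency_of_real le_top hm hadd hn)
  | pos =>
    exact exists_frequency_of_axes (fun p _ h0 k => posOrthant_single h0 k)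
      (fun j _ => exists_nonneg_add_nonneg_of_abs_mem fun k => abs_nonneg _) hadd hn
      (exists_axis_frequency_of_real le_rfl hm hadd hn)

end Characters

/-! ### Invariant kernels and eigenfunctions -/

section CommonEigenvector

variable {E ι : Type*} [AddCommGroup E] [Module ℂ E]

/-- Commuting operators have a common eigenvector in each finite-dimensional invariant subspace. If
one of them is not scalar, then its eigenspaces are smaller invariant subspaces. -/
theorem exists_common_eigenvector {U : ι → Module.End ℂ E}
    (hcomm : ∀ i j v, U i (U j v) = U j (U i v)) (V : Submodule ℂ E) [FiniteDimensional ℂ V]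
    (hV : V ≠ ⊥) (hinv : ∀ i, ∀ v ∈ V, U i v ∈ V) :
    ∃ v ∈ V, v ≠ 0 ∧ ∀ i, ∃ c : ℂ, U i v = c • v := by
  induction hn : Module.finrank ℂ V using Nat.strong_induction_on generalizing V with
  | _ n ih =>
    by_cases hscalar : ∀ i, ∃ c : ℂ, ∀ v ∈ V, U i v = c • v
    · obtain ⟨v, hv, hv0⟩ := Submodule.exists_mem_ne_zero_of_ne_bot hV
      exact ⟨v, hv, hv0, fun i => (hscalar i).imp fun c hc => hc v hv⟩
    push Not at hscalar
    obtain ⟨i, hi⟩ := hscalar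
    have : Nontrivial V := Submodule.nontrivial_iff_ne_bot.2 hV
    obtain ⟨c, hc⟩ := Module.End.exists_eigenvalue ((U i).restrict (hinv i))
    obtain ⟨⟨v, hv⟩, hvc⟩ := hc.exists_hasEigenvector
    have hv1 : U i v = c • v := congrArg Subtype.val hvc.apply_eq_smul
    have hv0 : v ≠ 0 := fun h => hvc.2 (Subtype.ext h)
    set W : Submodule ℂ E := V ⊓ Module.End.eigenspace (U i) c with hW
    have hmem : ∀ {u}, u ∈ W ↔ u ∈ V ∧ U i u = c • u := by
      intro u
      rw [hW, Submodule.mem_inf, Module.End.mem_eigenspace_iff]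
    have hWV : W < V := by
      refine lt_of_le_of_ne inf_le_left fun heq => ?_
      obtain ⟨u, hu, hne⟩ := hi c
      exact hne (hmem.1 (heq ▸ hu)).2
    have : FiniteDimensional ℂ W := Submodule.finiteDimensional_of_le hWV.le
    have hW0 : W ≠ ⊥ := fun h => hv0 ((Submodule.mem_bot ℂ).1 (h ▸ hmem.2 ⟨hv, hv1⟩))
    have hWinv : ∀ j, ∀ u ∈ W, U j u ∈ W := by
      intro j u hu
      obtain ⟨h1, h2⟩ := hmem.1 hu
      exact hmem.2 ⟨hinv j u h1, by rw [hcomm, h2, map_smul]⟩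
    obtain ⟨u, hu, hu'⟩ := ih _ (hn ▸ Submodule.finrank_lt_finrank_of_lt hWV) W hW0 hWinv rfl
    exact ⟨u, (hmem.1 hu).1, hu'⟩

end CommonEigenvector

/-- A compact self-adjoint operator without eigenvectors to nonzero eigenvalues in an invariant
subspace vanishes there, by the spectral theorem. -/
theorem apply_eq_zero_of_forall_eigenvector {E : Type*} [NormedAddCommGroup E]
    [InnerProductSpace ℂ E] {A : E →L[ℂ] E} (hAc : IsCompactOperator A) (hAs : A.IsSymmetric)
    (V : Submodule ℂ E) [CompleteSpace V] (hAV : ∀ v ∈ V, A v ∈ V)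
    (hev : ∀ c : ℂ, c ≠ 0 → ∀ v ∈ V, A v = c • v → v = 0) {f : E} (hf : f ∈ V) : A f = 0 := by
  let R : V →L[ℂ] V := A.restrict hAV
  have hRc : IsCompactOperator R := hAc.restrict' hAV
  have hRs : R.IsSymmetric := hAs.restrict_invariant hAV
  have hR : R = 0 := by
    refine (ContinuousLinearMap.eq_zero_of_forall_hasEigenvalue_eq_zero hRc hRs).1 fun c hc => ?_
    by_contra hc0
    obtain ⟨⟨v, hv⟩, hvc⟩ := hc.exists_hasEigenvector
    exact hvc.2 (Subtype.ext (hev c hc0 v hv (congrArg Subtype.val hvc.apply_eq_smul)))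
  exact congrArg Subtype.val (DFunLike.congr_fun hR ⟨f, hf⟩)

namespace MPSystem

open ContinuousLinearMap (adjoint)

variable {d : ℕ} {𝔾 : AddSubmonoid (Fin d → ℝ)} {ν : Measure 𝔾} {X : Type*} [MeasurableSpace X]
  {μ : Measure X}

theorem IsEigenfunction.exists_expChar {S : MPSystem 𝔾 X μ} {e : Lp ℂ 2 μ}
    (he : S.IsEigenfunction e) : ∃ w : Fin d → ℝ, ∀ j : 𝔾,
      S.koopmanL j e = expChar (∑ k, w k * (j : Fin d → ℝ) k) • e := he.2

/-- The (algebraic) linear span of the eigenfunctions. -/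
def eigenSpan (S : MPSystem 𝔾 X μ) : Submodule ℂ (Lp ℂ 2 μ) :=
  Submodule.span ℂ {f | S.IsEigenfunction f}

theorem mem_orthogonal_eigenSpan (S : MPSystem 𝔾 X μ) {f : Lp ℂ 2 μ} :
    f ∈ S.eigenSpanᗮ ↔ ∀ e, S.IsEigenfunction e → inner ℂ e f = 0 := by
  constructor
  · exact fun hf e he => (Submodule.mem_orthogonal _ _).1 hf e (Submodule.subset_span he)
  · intro h
    rw [Submodule.mem_orthogonal]
    intro u hu
    induction hu using Submodule.span_induction with
    | mem e he => exact h e he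
    | zero => exact inner_zero_left _
    | add u v _ _ hu hv => rw [inner_add_left, hu, hv, add_zero]
    | smul c u _ hu => rw [inner_smul_left, hu, mul_zero]

theorem measurable_inner_koopman (S : MPSystem 𝔾 X μ) [SFinite μ] (f : Lp ℂ 2 μ) :
    Measurable fun j => inner ℂ f (S.koopman j f) := by
  have h : (fun j => inner ℂ f (S.koopman j f)) = fun j => ∫ x, inner ℂ (f x) (f (S.T j x)) ∂μ := by
    funext j
    rw [L2.inner_def]
    refine integral_congr_ae ?_
    filter_upwards [S.coeFn_koopman j f] with x hx
    rw [hx]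
  rw [h]
  have hf : Measurable f := (Lp.stronglyMeasurable f).measurable
  have hm : Measurable fun p : 𝔾 × X => inner ℂ (f p.2) (f (S.T p.1 p.2)) :=
    (hf.comp measurable_snd).inner (hf.comp S.measurable_T)
  exact (hm.stronglyMeasurable.integral_prod_right' (ν := μ)).measurable

/-- A common eigenvector of the Koopman operators is an eigenfunction: its eigenvalues form a
measurable unitary character of `𝔾`. -/
theorem isEigenfunction_of_forall_exists (S : MPSystem 𝔾 X μ) [SFinite μ] (h𝔾 : IsTimes d 𝔾 ν)
    {f : Lp ℂ 2 μ} (hf : f ≠ 0) (h : ∀ j, ∃ c : ℂ, S.koopmanIso j f = c • f) :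
    S.IsEigenfunction f := by
  choose χ hχ using h
  have hf' : inner ℂ f f ≠ 0 := fun h => hf (inner_self_eq_zero.1 h)
  have hmeas : Measurable χ := by
    have h1 : χ = fun j => inner ℂ f (S.koopman j f) / inner ℂ f f := by
      funext j
      rw [← koopmanIso_apply, hχ, inner_smul_right, mul_div_cancel_right₀ _ hf']
    rw [h1]
    exact (S.measurable_inner_koopman f).div_const _
  obtain ⟨w, hw⟩ := h𝔾.exists_frequency hmeas
    (fun i j => by
      have h1 := S.koopmanIso_add i j f
      rw [hχ, hχ, map_smul, hχ, smul_smul, mul_comm] at h1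
      exact smul_left_injective ℂ hf h1)
    (fun j => by
      have h1 := (S.koopmanIso j).norm_map f
      rw [hχ, norm_smul] at h1
      exact (mul_eq_right₀ (norm_ne_zero_iff.2 hf)).1 h1)
  refine ⟨hf, w, fun j => ?_⟩
  rw [← koopmanIso_apply, hχ, hw]
  rfl

theorem koopmanL_mem_orthogonal_eigenSpan (S : MPSystem 𝔾 X μ) {f : Lp ℂ 2 μ}
    (hf : f ∈ S.eigenSpanᗮ) (j : 𝔾) : S.koopmanL j f ∈ S.eigenSpanᗮ := by
  rw [mem_orthogonal_eigenSpan] at hf ⊢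
  intro e he
  obtain ⟨w, hw⟩ := he.exists_expChar
  have h1 := S.inner_koopmanL j e f
  rw [hw, inner_smul_left, hf e he] at h1
  exact (mul_eq_zero.1 h1).resolve_left
    ((map_ne_zero (starRingEnd ℂ)).2 (expChar_ne_zero _))

/-- The integral operators with invariant kernels vanish on the orthogonal complement of the
eigenfunctions. For `A = L* L`, where `L` is such an operator, is compact and self-adjoint and
commutes with the Koopman operators. If it did not vanish there, it would have a nonzero eigenvalue
there, with a finite-dimensional eigenspace, and this would contain a common eigenvector of the
Koopman operators. -/
theorem kernelOp_eq_zero_of_mem_orthogonal (S : MPSystem 𝔾 X μ) [IsProbabilityMeasure μ]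
    (h𝔾 : IsTimes d 𝔾 ν) {K : Lp ℂ 2 (μ.prod μ)} (hK : ∀ j, S.selfProd.koopmanIso j K = K)
    {f : Lp ℂ 2 μ} (hf : f ∈ S.eigenSpanᗮ) : kernelOp K f = 0 := by
  set A : Lp ℂ 2 μ →L[ℂ] Lp ℂ 2 μ := (adjoint (kernelOp K)).comp (kernelOp K) with hA
  have hAc : IsCompactOperator A := by
    exact (isCompactOperator_kernelOp K).clm_comp (adjoint (kernelOp K))
  have hAs : A.IsSymmetric := fun u v => by
    change inner ℂ (adjoint (kernelOp K) (kernelOp K u)) v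
      = inner ℂ u (adjoint (kernelOp K) (kernelOp K v))
    rw [ContinuousLinearMap.adjoint_inner_left, ContinuousLinearMap.adjoint_inner_right]
  have hAU : ∀ j u, A (S.koopmanL j u) = S.koopmanL j (A u) := fun j u => by
    rw [hA, ContinuousLinearMap.comp_apply, ContinuousLinearMap.comp_apply,
      S.kernelOp_koopmanL hK, S.adjoint_kernelOp_koopmanL hK]
  have hAV : ∀ v ∈ S.eigenSpanᗮ, A v ∈ S.eigenSpanᗮ := by
    intro v hv
    rw [mem_orthogonal_eigenSpan] at hv ⊢
    intro e he
    have h1 : inner ℂ e (A v) = inner ℂ (A e) v := (hAs e v).symm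
    rw [h1]
    rcases eq_or_ne (A e) 0 with h0 | h0
    · rw [h0, inner_zero_left]
    · obtain ⟨w, hw⟩ := he.exists_expChar
      exact hv _ ⟨h0, w, fun j => by
        change S.koopmanL j (A e) = _
        rw [← hAU, hw, map_smul]
        rfl⟩
  have hev : ∀ c : ℂ, c ≠ 0 → ∀ v ∈ S.eigenSpanᗮ, A v = c • v → v = 0 := by
    intro c hc v hv hvc
    by_contra hv0
    have hfd : FiniteDimensional ℂ (Module.End.eigenspace A.toLinearMap c) :=
      ContinuousLinearMap.finite_dimensional_eigenspace hAc c hc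
    set W : Submodule ℂ (Lp ℂ 2 μ) := S.eigenSpanᗮ ⊓ Module.End.eigenspace A.toLinearMap c with hW
    have hmem : ∀ {u}, u ∈ W ↔ u ∈ S.eigenSpanᗮ ∧ A u = c • u := by
      intro u
      rw [hW, Submodule.mem_inf, Module.End.mem_eigenspace_iff]
      rfl
    have : FiniteDimensional ℂ W := Submodule.finiteDimensional_of_le inf_le_right
    obtain ⟨u, hu, hu0, hux⟩ := exists_common_eigenvector
      (U := fun j => (S.koopmanL j).toLinearMap) (fun i j u => S.koopmanIso_comm i j u) W
      (fun h => hv0 ((Submodule.mem_bot ℂ).1 (h ▸ hmem.2 ⟨hv, hvc⟩)))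
      (fun j u hu => by
        obtain ⟨h1, h2⟩ := hmem.1 hu
        refine hmem.2 ⟨S.koopmanL_mem_orthogonal_eigenSpan h1 j, ?_⟩
        change A (S.koopmanL j u) = c • S.koopmanL j u
        rw [hAU, h2, map_smul])
    exact hu0 (inner_self_eq_zero.1 ((S.mem_orthogonal_eigenSpan.1 (hmem.1 hu).1) u
      (S.isEigenfunction_of_forall_exists h𝔾 hu0 hux)))
  have hAf : A f = 0 := apply_eq_zero_of_forall_eigenvector hAc hAs _ hAV hev hf
  have h1 : inner ℂ (kernelOp K f) (kernelOp K f) = 0 := by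
    rw [← ContinuousLinearMap.adjoint_inner_right]
    change inner ℂ f (A f) = 0
    rw [hAf, inner_zero_right]
  exact inner_self_eq_zero.1 h1

end MPSystem

/-! ### Mean sensitivity from vanishing correlations -/

namespace MPSystem

open scoped ComplexConjugate

variable {d : ℕ} {𝔾 : AddSubmonoid (Fin d → ℝ)} {ν : Measure 𝔾} {X : Type*} [MeasurableSpace X]
  {μ : Measure X}

/-- The orbits of almost all points avoid a given null set at almost all times. Therefore the choice
of a representative of a function in `L²` does not matter. -/
theorem ae_orbit_of_ae (S : MPSystem 𝔾 X μ) [SFinite μ] [SFinite ν] {p : X → Prop}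
    (h : ∀ᵐ x ∂μ, p x) : ∀ᵐ x ∂μ, ∀ᵐ j ∂ν, p (S.T j x) := by
  obtain ⟨t, ht, htm, ht0⟩ := exists_measurable_superset_of_null (ae_iff.1 h)
  have hall : ∀ j, ∀ᵐ x ∂μ, S.T j x ∉ t := fun j =>
    (S.measurePreserving j).quasiMeasurePreserving.ae (measure_eq_zero_iff_ae_notMem.1 ht0)
  have hm : MeasurableSet {q : 𝔾 × X | S.T q.1 q.2 ∉ t} := (S.measurable_T htm).compl
  filter_upwards [(Measure.ae_ae_comm (μ := ν) (ν := μ) hm).1 (ae_of_all _ hall)] with x hx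
  filter_upwards [hx] with j hj
  by_contra hp
  exact hj (ht hp)

theorem lintegral_div_eq_ofReal_average {α : Type*} [MeasurableSpace α] {ρ : Measure α}
    {s : Set α} (h0 : ρ s ≠ 0) (htop : ρ s ≠ ∞) {h : α → ℂ}
    (hi : IntegrableOn (fun j => ‖h j‖ ^ 2) s ρ) :
    (∫⁻ j in s, ‖h j‖ₑ ^ 2 ∂ρ) / ρ s = ENNReal.ofReal (⨍ j in s, ‖h j‖ ^ 2 ∂ρ) := by
  have h1 : ∫⁻ j in s, ‖h j‖ₑ ^ 2 ∂ρ = ENNReal.ofReal (∫ j in s, ‖h j‖ ^ 2 ∂ρ) := by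
    rw [ofReal_integral_eq_lintegral_ofReal hi (ae_of_all _ fun _ => by positivity)]
    simp_rw [ENNReal.ofReal_pow (norm_nonneg _), ofReal_norm]
  have hpos : 0 < ρ.real s := ENNReal.toReal_pos h0 htop
  rw [h1, setAverage_eq, smul_eq_mul, ENNReal.ofReal_mul (inv_nonneg.2 hpos.le),
    ENNReal.ofReal_inv_of_pos hpos, measureReal_def, ENNReal.ofReal_toReal htop,
    ENNReal.div_eq_inv_mul]

/-- The pointwise ergodic theorem for `|f|²`. -/
theorem IsErgodic.ae_tendsto_average_sq {S : MPSystem 𝔾 X μ} (hS : S.IsErgodic)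
    (hν : AdmissibleTimes 𝔾 ν) [IsProbabilityMeasure μ] (f : Lp ℂ 2 μ) :
    ∀ᵐ x ∂μ, (∀ n, IntegrableOn (fun j => ‖f (S.T j x)‖ ^ 2) (box 𝔾 n) ν) ∧
      Tendsto (fun n => ⨍ j in box 𝔾 n, ‖f (S.T j x)‖ ^ 2 ∂ν) atTop (𝓝 (‖f‖ ^ 2)) := by
  set g : X → ℂ := fun x => ((‖f x‖ ^ 2 : ℝ) : ℂ) with hg
  have hgm : Measurable g :=
    Complex.measurable_ofReal.comp ((Lp.stronglyMeasurable f).measurable.norm.pow_const 2)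
  have hgi : Integrable g μ := (Lp.memLp f).norm.integrable_sq.ofReal
  have hint : ∫ x, g x ∂μ = ((‖f‖ ^ 2 : ℝ) : ℂ) := by
    have h1 : inner ℂ f f = ∫ x, g x ∂μ := by
      rw [L2.inner_def]
      refine integral_congr_ae (ae_of_all _ fun x => ?_)
      simp only [hg]
      rw [inner_self_eq_norm_sq_to_K]
      push_cast
      rfl
    rw [← h1, inner_self_eq_norm_sq_to_K]
    push_cast
    rfl
  filter_upwards [hS.ae_tendsto_avg hν hgm hgi, S.ae_integrableOn_box hν hgm hgi] with x hx hxi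
  refine ⟨fun n => ?_, ?_⟩
  · have := (hxi n).re
    simp only [hg, RCLike.re_eq_complex_re, Complex.ofReal_re] at this
    exact this
  · rw [hint] at hx
    have h1 := (Complex.continuous_re.tendsto _).comp hx
    rw [Complex.ofReal_re] at h1
    refine h1.congr fun n => ?_
    simp only [Function.comp_apply, avg, setAverage_eq, hg]
    have h2 : ∫ j in box 𝔾 n, ((‖f (S.T j x)‖ ^ 2 : ℝ) : ℂ) ∂ν
        = ((∫ j in box 𝔾 n, ‖f (S.T j x)‖ ^ 2 ∂ν : ℝ) : ℂ) := integral_ofReal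
    rw [h2, Complex.real_smul, ← Complex.ofReal_mul, Complex.ofReal_re, smul_eq_mul]

theorem isGenericSq_of_tendsto {S : MPSystem 𝔾 X μ} (hν : AdmissibleTimes 𝔾 ν) {f : Lp ℂ 2 μ}
    {x : X} (hi : ∀ n, IntegrableOn (fun j => ‖f (S.T j x)‖ ^ 2) (box 𝔾 n) ν)
    (hx : Tendsto (fun n => ⨍ j in box 𝔾 n, ‖f (S.T j x)‖ ^ 2 ∂ν) atTop (𝓝 (‖f‖ ^ 2))) :
    S.IsGenericSq ν f x := by
  have h1 : ∫⁻ z, ‖f z‖ₑ ^ 2 ∂μ = ENNReal.ofReal (‖f‖ ^ 2) := by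
    have h2 := eLpNorm_nnreal_pow_eq_lintegral (f := f) (μ := μ) (p := 2) two_ne_zero
    rw [ENNReal.ofReal_pow (norm_nonneg _), ofReal_norm, Lp.enorm_def]
    simpa using h2.symm
  rw [IsGenericSq, h1]
  refine ((ENNReal.continuous_ofReal.tendsto _).comp hx).congr' ?_
  filter_upwards [eventually_ne_atTop 0] with n hn
  exact (lintegral_div_eq_ofReal_average (hν.measure_box_ne_zero hn)
    (hν.measure_box_ne_top n) (hi n)).symm

theorem average_norm_sub_sq {α : Type*} [MeasurableSpace α] {ρ : Measure α} {s : Set α}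
    {u v : α → ℂ} (hu : Measurable u) (hv : Measurable v)
    (hui : IntegrableOn (fun j => ‖u j‖ ^ 2) s ρ) (hvi : IntegrableOn (fun j => ‖v j‖ ^ 2) s ρ) :
    IntegrableOn (fun j => ‖u j - v j‖ ^ 2) s ρ ∧
    ⨍ j in s, ‖u j - v j‖ ^ 2 ∂ρ = ⨍ j in s, ‖u j‖ ^ 2 ∂ρ + ⨍ j in s, ‖v j‖ ^ 2 ∂ρ
      - 2 * (⨍ j in s, u j * conj (v j) ∂ρ).re := by
  have hu2 : MemLp u 2 (ρ.restrict s) :=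
    (memLp_two_iff_integrable_sq_norm hu.aestronglyMeasurable).2 hui
  have hv2 : MemLp v 2 (ρ.restrict s) :=
    (memLp_two_iff_integrable_sq_norm hv.aestronglyMeasurable).2 hvi
  have huv : IntegrableOn (fun j => u j * conj (v j)) s ρ := hu2.integrable_mul hv2.star
  refine ⟨(hu2.sub hv2).norm.integrable_sq, ?_⟩
  have hpt : ∀ j, ‖u j - v j‖ ^ 2 = ‖u j‖ ^ 2 + ‖v j‖ ^ 2 - 2 * (u j * conj (v j)).re := by
    intro j
    simp only [← Complex.normSq_eq_norm_sq]
    exact Complex.normSq_sub _ _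
  have hre : ∫ j in s, (u j * conj (v j)).re ∂ρ = (∫ j in s, u j * conj (v j) ∂ρ).re :=
    integral_re huv
  simp_rw [hpt]
  simp only [setAverage_eq]
  have hre' : IntegrableOn (fun j => 2 * (u j * conj (v j)).re) s ρ := huv.re.const_mul 2
  have hadd : IntegrableOn (fun j => ‖u j‖ ^ 2 + ‖v j‖ ^ 2) s ρ := hui.add hvi
  rw [integral_sub hadd hre', integral_add hui hvi, integral_const_mul, hre,
    Complex.real_smul, Complex.re_ofReal_mul]
  simp only [smul_eq_mul]
  ring

/-- If the correlations of the orbits of `x` and `y` are small infinitely often, then `x` and `y`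
are far apart on average. -/
theorem lt_meanDist (S : MPSystem 𝔾 X μ) (hν : AdmissibleTimes 𝔾 ν) {f₀ : Lp ℂ 2 μ}
    (hf₀ : f₀ ≠ 0) {f : X → ℂ} {x y : X}
    (hxi : ∀ n, IntegrableOn (fun j => ‖f₀ (S.T j x)‖ ^ 2) (box 𝔾 n) ν)
    (hx : Tendsto (fun n => ⨍ j in box 𝔾 n, ‖f₀ (S.T j x)‖ ^ 2 ∂ν) atTop (𝓝 (‖f₀‖ ^ 2)))
    (hyi : ∀ n, IntegrableOn (fun j => ‖f₀ (S.T j y)‖ ^ 2) (box 𝔾 n) ν)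
    (hy : Tendsto (fun n => ⨍ j in box 𝔾 n, ‖f₀ (S.T j y)‖ ^ 2 ∂ν) atTop (𝓝 (‖f₀‖ ^ 2)))
    (hcorr : liminf (fun n => ‖⨍ j in box 𝔾 n, f₀ (S.T j x) * conj (f₀ (S.T j y)) ∂ν‖ₑ) atTop = 0)
    (hf : ∀ᵐ j ∂ν, f (S.T j x) - f (S.T j y) = f₀ (S.T j x) - f₀ (S.T j y)) :
    ENNReal.ofReal ‖f₀‖ < S.meanDist ν f x y := by
  set N := ‖f₀‖ with hN
  have hNpos : 0 < N := norm_pos_iff.2 hf₀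
  have hfm : Measurable f₀ := (Lp.stronglyMeasurable f₀).measurable
  -- If the correlation is at most `N ^ 2 / 8` and both averages are at least `7 / 8 * N ^ 2`, then
  -- the average of the squared distance is at least `(7 / 8 + 7 / 8 - 2 / 8) * N ^ 2`.
  have hlt : ENNReal.ofReal N < ENNReal.ofReal (3 / 2 * N ^ 2) ^ (1 / 2 : ℝ) := by
    rw [ENNReal.ofReal_rpow_of_pos (by positivity), ENNReal.ofReal_lt_ofReal_iff (by positivity),
      ← Real.sqrt_eq_rpow]
    exact Real.lt_sqrt_of_sq_lt (by nlinarith)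
  refine hlt.trans_le (le_limsup_of_frequently_le ?_)
  have hfreq : ∃ᶠ n in atTop,
      ‖⨍ j in box 𝔾 n, f₀ (S.T j x) * conj (f₀ (S.T j y)) ∂ν‖ₑ < ENNReal.ofReal (N ^ 2 / 8) :=
    frequently_lt_of_liminf_lt (by isBoundedDefault)
      (by rw [hcorr]; exact ENNReal.ofReal_pos.2 (by positivity))
  have hxe : ∀ᶠ n in atTop, 7 / 8 * N ^ 2 < ⨍ j in box 𝔾 n, ‖f₀ (S.T j x)‖ ^ 2 ∂ν :=
    hx.eventually_const_lt (by nlinarith [sq_pos_of_pos hNpos])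
  have hye : ∀ᶠ n in atTop, 7 / 8 * N ^ 2 < ⨍ j in box 𝔾 n, ‖f₀ (S.T j y)‖ ^ 2 ∂ν :=
    hy.eventually_const_lt (by nlinarith [sq_pos_of_pos hNpos])
  refine (hfreq.and_eventually ((hxe.and hye).and (eventually_ne_atTop 0))).mono ?_
  rintro n ⟨h1, ⟨h2, h3⟩, hn⟩
  refine ENNReal.rpow_le_rpow ?_ (by norm_num)
  obtain ⟨hi, heq⟩ := average_norm_sub_sq (hfm.comp (S.measurable_orbit x))
    (hfm.comp (S.measurable_orbit y)) (hxi n) (hyi n)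
  simp only [Function.comp_apply] at hi heq
  have hcongr : ∫⁻ j in box 𝔾 n, ‖f (S.T j x) - f (S.T j y)‖ₑ ^ 2 ∂ν
      = ∫⁻ j in box 𝔾 n, ‖f₀ (S.T j x) - f₀ (S.T j y)‖ₑ ^ 2 ∂ν := by
    refine lintegral_congr_ae (ae_restrict_of_ae ?_)
    filter_upwards [hf] with j hj
    rw [hj]
  rw [hcongr, lintegral_div_eq_ofReal_average (hν.measure_box_ne_zero hn)
    (hν.measure_box_ne_top n) hi, heq]
  refine ENNReal.ofReal_le_ofReal ?_
  rw [← ofReal_norm, ENNReal.ofReal_lt_ofReal_iff (by positivity)] at h1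
  have h4 := (Complex.abs_re_le_norm _).trans h1.le
  rw [abs_le] at h4
  linarith [h4.2]

/-- A function which, up to a constant, has no correlation with the invariant functions of the
product system is mean sensitive: for almost every pair `(x, y)` the ergodic averages of
`f₀ ⊗ conj f₀` have `0` as a limit point, by the mean ergodic theorem and Fatou's lemma. Adding a
constant does not affect `d_f`; the genericity of `x` and `y` is required for `f` itself. -/
theorem mem_Hms_of_inner_tensor [IsProbabilityMeasure μ] {S : MPSystem 𝔾 X μ} (hS : S.IsErgodic)
    (hν : AdmissibleTimes 𝔾 ν) {f f₀ : Lp ℂ 2 μ} (hf₀ : f₀ ≠ 0) (c : ℂ)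
    (hf : f =ᵐ[μ] fun x => f₀ x + c)
    (h : ∀ K : Lp ℂ 2 (μ.prod μ), (∀ j, S.selfProd.koopmanIso j K = K) →
      inner ℂ K (tensor f₀ f₀) = 0) : f ∈ S.Hms ν := by
  have := hν.sigmaFinite
  refine ⟨‖f₀‖, norm_pos_iff.2 hf₀, fun A _ hA0 => ?_⟩
  have hGm : Measurable (tensor f₀ f₀) := (Lp.stronglyMeasurable _).measurable
  have hlim := S.selfProd.tendsto_lintegral_avg hν h
  have hliminf : ∀ᵐ p ∂μ.prod μ,
      liminf (fun n => ‖S.selfProd.avg ν n (tensor f₀ f₀) p‖ₑ) atTop = 0 := by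
    have hm : ∀ n, Measurable fun p => ‖S.selfProd.avg ν n (tensor f₀ f₀) p‖ₑ := fun n =>
      (S.selfProd.measurable_avg hGm n).enorm
    have h1 := lintegral_liminf_le (μ := μ.prod μ) (u := atTop) hm
    rw [hlim.liminf_eq, nonpos_iff_eq_zero, lintegral_eq_zero_iff (Measurable.liminf hm)] at h1
    exact h1
  have hgood := hS.ae_tendsto_average_sq hν f₀
  have hgood' := hS.ae_tendsto_average_sq hν f
  have horb := S.ae_orbit_of_ae (ν := ν) hf
  have horb' := S.selfProd.ae_orbit_of_ae (ν := ν) (coeFn_tensor f₀ f₀)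
  have hpos : (μ.prod μ) (A ×ˢ A) ≠ 0 := by
    rw [Measure.prod_prod]
    exact mul_ne_zero hA0.ne' hA0.ne'
  obtain ⟨⟨x, y⟩, hxy, h1, h2, h3, h4, h5, h6, h7, h8⟩ :=
    ((frequently_ae_mem_iff.2 hpos).and_eventually
      (hliminf.and (horb'.and ((ae_fst hgood).and ((ae_snd hgood).and ((ae_fst hgood').and
        ((ae_snd hgood').and ((ae_fst horb).and (ae_snd horb))))))))).exists
  refine ⟨x, hxy.1, y, hxy.2, isGenericSq_of_tendsto hν h5.1 h5.2,
    isGenericSq_of_tendsto hν h6.1 h6.2, ?_⟩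
  refine S.lt_meanDist hν hf₀ h3.1 h3.2 h4.1 h4.2 ?_ ?_
  · rw [← h1]
    congr 1
    funext n
    rw [avg]
    congr 1
    refine average_congr (ae_restrict_of_ae ?_)
    filter_upwards [h2] with j hj using hj.symm
  · filter_upwards [h7, h8] with j hj hj'
    rw [hj, hj']
    ring

end MPSystem

/-! ### Limits of linear combinations of eigenfunctions -/

namespace MPSystem

open scoped ComplexConjugate

variable {d : ℕ} {𝔾 : AddSubmonoid (Fin d → ℝ)} {ν : Measure 𝔾} {X : Type*} [MeasurableSpace X]
  {μ : Measure X}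

theorem exists_measurable_subset_of_ae {B : Set X} (hB : MeasurableSet B) (h0 : μ B ≠ 0)
    {p : X → Prop} (hp : ∀ᵐ x ∂μ, p x) :
    ∃ A ⊆ B, MeasurableSet A ∧ μ A ≠ 0 ∧ ∀ x ∈ A, p x := by
  obtain ⟨t, ht, htm, ht0⟩ := exists_measurable_superset_of_null (ae_iff.1 hp)
  refine ⟨B \ t, sdiff_subset, hB.diff htm, by rwa [measure_sdiff_null ht0], fun x hx => ?_⟩
  by_contra hpx
  exact hx.2 (ht hpx)

/-- Each set of positive measure has a subset of positive measure on which the orbits of any two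
points are uniformly close, as far as a linear combination of eigenfunctions sees them. For an
eigenfunction it suffices that its values vary little on the subset. -/
theorem exists_subset_of_mem_eigenSpan (S : MPSystem 𝔾 X μ) [SFinite μ] [SFinite ν]
    {g : Lp ℂ 2 μ} (hg : g ∈ S.eigenSpan) {η : ℝ} (hη : 0 < η) {B : Set X}
    (hB : MeasurableSet B) (h0 : μ B ≠ 0) :
    ∃ A ⊆ B, MeasurableSet A ∧ μ A ≠ 0 ∧
      ∀ x ∈ A, ∀ y ∈ A, ∀ᵐ j ∂ν, ‖g (S.T j x) - g (S.T j y)‖ ≤ η := by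
  induction hg using Submodule.span_induction generalizing η B with
  | mem e he =>
    obtain ⟨w, hw⟩ := he.exists_expChar
    have hem : Measurable e := (Lp.stronglyMeasurable e).measurable
    have hchar : Measurable fun j : 𝔾 => expChar (∑ k, w k * (j : Fin d → ℝ) k) := by
      have hexp : Continuous expChar := by unfold expChar; fun_prop
      have hcoord : ∀ k, Measurable fun j : 𝔾 => (j : Fin d → ℝ) k := fun k =>
        (measurable_pi_apply k).comp measurable_subtype_coe
      exact hexp.measurable.comp (Finset.measurable_sum _ fun k _ => (hcoord k).const_mul (w k))
    have hall : ∀ j : 𝔾, ∀ᵐ x ∂μ, e (S.T j x) = expChar (∑ k, w k * (j : Fin d → ℝ) k) * e x := by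
      intro j
      have h1 := S.coeFn_koopman j e
      have h2 : S.koopman j e = expChar (∑ k, w k * (j : Fin d → ℝ) k) • e := hw j
      rw [h2] at h1
      filter_upwards [h1, Lp.coeFn_smul (expChar (∑ k, w k * (j : Fin d → ℝ) k)) e] with x h3 h4
      rw [← h3, h4, Pi.smul_apply, smul_eq_mul]
    have hm : MeasurableSet {q : 𝔾 × X |
        e (S.T q.1 q.2) = expChar (∑ k, w k * (q.1 : Fin d → ℝ) k) * e q.2} :=
      measurableSet_eq_fun (hem.comp S.measurable_T)
        ((hchar.comp measurable_fst).mul (hem.comp measurable_snd))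
    obtain ⟨B', hB'B, hB'm, hB'0, hB'⟩ := exists_measurable_subset_of_ae hB h0
      ((Measure.ae_ae_comm (μ := ν) (ν := μ) hm).1 (ae_of_all _ hall))
    obtain ⟨n, hn⟩ :
        ∃ n, 0 < μ (B' ∩ e ⁻¹' Metric.ball (TopologicalSpace.denseSeq ℂ n) (η / 2)) := by
      refine exists_measure_pos_of_not_measure_iUnion_null ?_
      rw [← inter_iUnion, ← preimage_iUnion]
      have : ⋃ n, Metric.ball (TopologicalSpace.denseSeq ℂ n) (η / 2) = univ := by
        refine eq_univ_of_forall fun z => mem_iUnion.2 ?_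
        obtain ⟨n, hn⟩ := (TopologicalSpace.denseRange_denseSeq ℂ).exists_dist_lt z (half_pos hη)
        exact ⟨n, hn⟩
      rwa [this, preimage_univ, inter_univ]
    refine ⟨_, inter_subset_left.trans hB'B, hB'm.inter (hem measurableSet_ball), hn.ne',
      fun x hx y hy => ?_⟩
    filter_upwards [hB' x hx.1, hB' y hy.1] with j h1 h2
    rw [h1, h2, ← mul_sub, norm_mul, norm_expChar, one_mul, ← dist_eq_norm]
    have h3 : dist (e x) (TopologicalSpace.denseSeq ℂ n) < η / 2 := hx.2
    have h4 : dist (e y) (TopologicalSpace.denseSeq ℂ n) < η / 2 := hy.2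
    linarith [dist_triangle_right (e x) (e y) (TopologicalSpace.denseSeq ℂ n)]
  | zero =>
    obtain ⟨A, hAB, hAm, hA0, hA⟩ := exists_measurable_subset_of_ae hB h0
      (S.ae_orbit_of_ae (ν := ν) (Lp.coeFn_zero ℂ 2 μ))
    refine ⟨A, hAB, hAm, hA0, fun x hx y hy => ?_⟩
    filter_upwards [hA x hx, hA y hy] with j h1 h2
    rw [h1, h2]
    simpa using hη.le
  | add u v _ _ hu hv =>
    obtain ⟨B₁, hB₁B, hB₁m, hB₁0, hB₁⟩ := exists_measurable_subset_of_ae hB h0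
      (S.ae_orbit_of_ae (ν := ν) (Lp.coeFn_add u v))
    obtain ⟨B₂, hB₂B, hB₂m, hB₂0, hB₂⟩ := hu (half_pos hη) hB₁m hB₁0
    obtain ⟨A, hAB, hAm, hA0, hA⟩ := hv (half_pos hη) hB₂m hB₂0
    refine ⟨A, hAB.trans (hB₂B.trans hB₁B), hAm, hA0, fun x hx y hy => ?_⟩
    filter_upwards [hA x hx y hy, hB₂ x (hAB hx) y (hAB hy), hB₁ x (hB₂B (hAB hx)),
      hB₁ y (hB₂B (hAB hy))] with j h1 h2 h3 h4
    rw [h3, h4, Pi.add_apply, Pi.add_apply, add_sub_add_comm]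
    linarith [norm_add_le (u (S.T j x) - u (S.T j y)) (v (S.T j x) - v (S.T j y))]
  | smul c u _ hu =>
    obtain ⟨B₁, hB₁B, hB₁m, hB₁0, hB₁⟩ := exists_measurable_subset_of_ae hB h0
      (S.ae_orbit_of_ae (ν := ν) (Lp.coeFn_smul c u))
    obtain ⟨A, hAB, hAm, hA0, hA⟩ := hu (η := η / (‖c‖ + 1)) (by positivity) hB₁m hB₁0
    refine ⟨A, hAB.trans hB₁B, hAm, hA0, fun x hx y hy => ?_⟩
    filter_upwards [hA x hx y hy, hB₁ x (hAB hx), hB₁ y (hAB hy)] with j h1 h2 h3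
    rw [h2, h3, Pi.smul_apply, Pi.smul_apply, ← smul_sub, norm_smul]
    rw [le_div_iff₀ (by positivity)] at h1
    nlinarith [norm_nonneg (u (S.T j x) - u (S.T j y)), norm_nonneg c]

theorem norm_add_add_sq_le (a b c : ℂ) :
    ‖a + b + c‖ ^ 2 ≤ 3 * (‖a‖ ^ 2 + ‖b‖ ^ 2 + ‖c‖ ^ 2) := by
  have h1 : ‖a + b + c‖ ≤ ‖a‖ + ‖b‖ + ‖c‖ :=
    (norm_add_le _ _).trans (add_le_add_left (norm_add_le _ _) _)
  have h2 : ‖a + b + c‖ ^ 2 ≤ (‖a‖ + ‖b‖ + ‖c‖) ^ 2 := pow_le_pow_left₀ (norm_nonneg _) h1 2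
  nlinarith [sq_nonneg (‖a‖ - ‖b‖), sq_nonneg (‖b‖ - ‖c‖), sq_nonneg (‖a‖ - ‖c‖)]

/-- A limit of linear combinations of eigenfunctions is not mean sensitive: by the pointwise
ergodic theorem its distance to the linear combination is seen with the right size along almost
every orbit. -/
theorem IsErgodic.notMem_Hms_of_mem_closure {S : MPSystem 𝔾 X μ} (hS : S.IsErgodic)
    (hν : AdmissibleTimes 𝔾 ν) [IsProbabilityMeasure μ] {f : Lp ℂ 2 μ}
    (hf : f ∈ S.eigenSpan.topologicalClosure) : f ∉ S.Hms ν := by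
  have := hν.sigmaFinite
  rintro ⟨ε, hε, hms⟩
  -- A sum of three terms of size `δ` has square at most `3 * (δ ^ 2 + δ ^ 2 + δ ^ 2) = ε ^ 2`.
  set δ := ε / 3 with hδ
  have hδpos : 0 < δ := by positivity
  obtain ⟨g, hg, hfg⟩ := Metric.mem_closure_iff.1 hf δ hδpos
  rw [dist_eq_norm] at hfg
  obtain ⟨B, -, hBm, hB0, hB⟩ := exists_measurable_subset_of_ae (μ := μ) MeasurableSet.univ
    (by simp) ((S.ae_orbit_of_ae (ν := ν) (Lp.coeFn_sub f g)).and
      (hS.ae_tendsto_average_sq hν (f - g)))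
  obtain ⟨A, hAB, hAm, hA0, hA⟩ := S.exists_subset_of_mem_eigenSpan (ν := ν) hg hδpos hBm hB0
  obtain ⟨x, hx, y, hy, -, -, hlt⟩ := hms A hAm (pos_iff_ne_zero.2 hA0)
  refine absurd hlt (not_lt.2 ?_)
  have hsq : ‖f - g‖ ^ 2 < δ ^ 2 := pow_lt_pow_left₀ hfg (norm_nonneg _) two_ne_zero
  refine limsup_le_of_le (by isBoundedDefault) ?_
  filter_upwards [(hB x (hAB hx)).2.2.eventually_lt_const hsq,
    (hB y (hAB hy)).2.2.eventually_lt_const hsq, eventually_ne_atTop 0] with n h1 h2 hn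
  have hb0 := hν.measure_box_ne_zero (𝔾 := 𝔾) hn
  have hbt := hν.measure_box_ne_top (𝔾 := 𝔾) n
  have hix := (hB x (hAB hx)).2.1 n
  have hiy := (hB y (hAB hy)).2.1 n
  set r : Lp ℂ 2 μ := f - g with hr
  have hrm : Measurable r := (Lp.stronglyMeasurable r).measurable
  have hmx : Measurable fun j => ‖r (S.T j x)‖ₑ ^ 2 :=
    (hrm.comp (S.measurable_orbit x)).enorm.pow_const 2
  have hmy : Measurable fun j => ‖r (S.T j y)‖ₑ ^ 2 :=
    (hrm.comp (S.measurable_orbit y)).enorm.pow_const 2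
  have hle : ∫⁻ j in box 𝔾 n, ‖f (S.T j x) - f (S.T j y)‖ₑ ^ 2 ∂ν
      ≤ ∫⁻ j in box 𝔾 n, 3 * (‖r (S.T j x)‖ₑ ^ 2 + ‖r (S.T j y)‖ₑ ^ 2
        + ENNReal.ofReal (δ ^ 2)) ∂ν := by
    refine lintegral_mono_ae (ae_restrict_of_ae ?_)
    filter_upwards [(hB x (hAB hx)).1, (hB y (hAB hy)).1, hA x hx y hy] with j h3 h4 h5
    have h6 : f (S.T j x) - f (S.T j y)
        = r (S.T j x) + -r (S.T j y) + (g (S.T j x) - g (S.T j y)) := by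
      rw [h3, h4, Pi.sub_apply, Pi.sub_apply]
      ring
    have h7 := norm_add_add_sq_le (r (S.T j x)) (-r (S.T j y)) (g (S.T j x) - g (S.T j y))
    rw [← h6, norm_neg] at h7
    have h8 : ‖f (S.T j x) - f (S.T j y)‖ ^ 2
        ≤ 3 * (‖r (S.T j x)‖ ^ 2 + ‖r (S.T j y)‖ ^ 2 + δ ^ 2) :=
      h7.trans (by
        have := pow_le_pow_left₀ (norm_nonneg _) h5 2
        linarith)
    have h9 := ENNReal.ofReal_le_ofReal h8
    rwa [ENNReal.ofReal_mul (by norm_num), ENNReal.ofReal_add (by positivity) (by positivity),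
      ENNReal.ofReal_add (by positivity) (by positivity), ENNReal.ofReal_pow (norm_nonneg _),
      ENNReal.ofReal_pow (norm_nonneg _), ENNReal.ofReal_pow (norm_nonneg _), ofReal_norm,
      ofReal_norm, ofReal_norm, ENNReal.ofReal_ofNat] at h9
  have hkey : (∫⁻ j in box 𝔾 n, ‖f (S.T j x) - f (S.T j y)‖ₑ ^ 2 ∂ν) / ν (box 𝔾 n)
      ≤ ENNReal.ofReal ε ^ 2 := by
    calc _ ≤ (∫⁻ j in box 𝔾 n, 3 * (‖r (S.T j x)‖ₑ ^ 2 + ‖r (S.T j y)‖ₑ ^ 2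
          + ENNReal.ofReal (δ ^ 2)) ∂ν) / ν (box 𝔾 n) := ENNReal.div_le_div_right hle _
      _ = 3 * ((∫⁻ j in box 𝔾 n, ‖r (S.T j x)‖ₑ ^ 2 ∂ν) / ν (box 𝔾 n)
          + (∫⁻ j in box 𝔾 n, ‖r (S.T j y)‖ₑ ^ 2 ∂ν) / ν (box 𝔾 n)
          + ENNReal.ofReal (δ ^ 2)) := by
          rw [lintegral_const_mul' _ _ (by norm_num),
            lintegral_add_right _ measurable_const, lintegral_add_right _ hmy, lintegral_const,
            Measure.restrict_apply_univ, mul_div_assoc, ENNReal.add_div, ENNReal.add_div,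
            ENNReal.mul_div_cancel_right hb0 hbt]
      _ ≤ 3 * (ENNReal.ofReal (δ ^ 2) + ENNReal.ofReal (δ ^ 2) + ENNReal.ofReal (δ ^ 2)) := by
          rw [lintegral_div_eq_ofReal_average hb0 hbt hix,
            lintegral_div_eq_ofReal_average hb0 hbt hiy]
          gcongr
      _ = ENNReal.ofReal ε ^ 2 := by
          rw [← ENNReal.ofReal_add (by positivity) (by positivity),
            ← ENNReal.ofReal_add (by positivity) (by positivity),
            ← ENNReal.ofReal_ofNat 3, ← ENNReal.ofReal_mul (by norm_num),
            ← ENNReal.ofReal_pow hε.le, hδ]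
          congr 1
          ring
  calc _ ≤ (ENNReal.ofReal ε ^ 2) ^ (1 / 2 : ℝ) := ENNReal.rpow_le_rpow hkey (by norm_num)
    _ = ENNReal.ofReal ε := by
      rw [← ENNReal.rpow_natCast, ← ENNReal.rpow_mul]
      norm_num

/-- Limits of linear combinations of eigenfunctions are almost periodic, since the orbit of a
linear combination of eigenfunctions lies in a compact subset of a finite-dimensional space. -/
theorem mem_Hap_of_mem_closure (S : MPSystem 𝔾 X μ) {f : Lp ℂ 2 μ}
    (hf : f ∈ S.eigenSpan.topologicalClosure) : f ∈ S.Hap := by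
  have hspan : ∀ g ∈ S.eigenSpan, ∃ L : Set (Lp ℂ 2 μ),
      IsCompact L ∧ ∀ j, S.koopmanIso j g ∈ L := by
    intro g hg
    induction hg using Submodule.span_induction with
    | mem e he =>
      obtain ⟨w, hw⟩ := he.exists_expChar
      refine ⟨(fun c : ℂ => c • e) '' Metric.closedBall 0 1,
        (isCompact_closedBall _ _).image (by fun_prop), fun j => ⟨_, ?_, (hw j).symm⟩⟩
      rw [mem_closedBall_zero_iff, norm_expChar]
    | zero => exact ⟨{0}, isCompact_singleton, fun j => by rw [_root_.map_zero]; rfl⟩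
    | add u v _ _ hu hv =>
      obtain ⟨L, hL, hL'⟩ := hu
      obtain ⟨M, hM, hM'⟩ := hv
      refine ⟨(fun p : Lp ℂ 2 μ × Lp ℂ 2 μ => p.1 + p.2) '' L ×ˢ M,
        (hL.prod hM).image (by fun_prop), fun j => ⟨(_, _), ⟨hL' j, hM' j⟩, ?_⟩⟩
      rw [_root_.map_add]
    | smul c u _ hu =>
      obtain ⟨L, hL, hL'⟩ := hu
      refine ⟨(fun v => c • v) '' L, hL.image (continuous_const_smul c), fun j => ⟨_, hL' j, ?_⟩⟩
      rw [map_smul]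
  have htb : TotallyBounded (range fun j => S.koopman j f) := by
    refine Metric.totallyBounded_iff.2 fun ε hε => ?_
    obtain ⟨g, hg, hfg⟩ := Metric.mem_closure_iff.1 hf (ε / 2) (half_pos hε)
    obtain ⟨L, hL, hL'⟩ := hspan g hg
    obtain ⟨t, ht, hLt⟩ := Metric.totallyBounded_iff.1 hL.totallyBounded (ε / 2) (half_pos hε)
    refine ⟨t, ht, ?_⟩
    rintro _ ⟨j, rfl⟩
    obtain ⟨y, hy, hy'⟩ := mem_iUnion₂.1 (hLt (hL' j))
    refine mem_iUnion₂.2 ⟨y, hy, ?_⟩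
    have h1 : dist (S.koopman j f) (S.koopmanIso j g) = dist f g :=
      (S.koopmanIso j).isometry.dist_eq f g
    have h2 : dist (S.koopmanIso j g) y < ε / 2 := hy'
    rw [Metric.mem_ball]
    linarith [dist_triangle (S.koopman j f) (S.koopmanIso j g) y]
  exact isCompact_iff_totallyBounded_isComplete.2 ⟨htb.closure, isClosed_closure.isComplete⟩

theorem HasDiscreteSpectrum.topologicalClosure_eigenSpan {S : MPSystem 𝔾 X μ}
    (h : S.HasDiscreteSpectrum) : S.eigenSpan.topologicalClosure = ⊤ := by
  obtain ⟨s, b, hb, hs⟩ := h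
  rw [← top_le_iff, ← b.dense_span]
  refine Submodule.topologicalClosure_mono (Submodule.span_mono ?_)
  rintro _ ⟨i, rfl⟩
  rw [hb]
  exact hs i i.2

/-- The projection of an eigenfunction to the orthogonal complement of other eigenfunctions is `0`
or an eigenfunction. The Koopman operator `U` need not be unitary, but it maps the complement into
itself, and `‖U r - χ • r‖² = 0` results from `⟪U r, χ • r⟫ = ⟪U r, U e⟫ = ⟪r, e⟫ = ⟪r, r⟫` for the
projection `r` of the eigenfunction `e` with eigenvalue `χ`. -/
theorem IsEigenfunction.sub_starProjection {S : MPSystem 𝔾 X μ} {e : Lp ℂ 2 μ}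
    (he : S.IsEigenfunction e) {s : Set (Lp ℂ 2 μ)} (hs : ∀ u ∈ s, S.IsEigenfunction u)
    (h0 : e - (Submodule.span ℂ s).topologicalClosure.starProjection e ≠ 0) :
    S.IsEigenfunction (e - (Submodule.span ℂ s).topologicalClosure.starProjection e) := by
  set V := (Submodule.span ℂ s).topologicalClosure with hV
  set r := e - V.starProjection e with hr
  have hrV : r ∈ Vᗮ := V.sub_starProjection_mem_orthogonal e
  obtain ⟨w, hw⟩ := he.exists_expChar
  refine ⟨h0, w, fun j => ?_⟩
  set χ := expChar (∑ k, w k * (j : Fin d → ℝ) k) with hχ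
  change S.koopmanL j r = χ • r
  have hUr : S.koopmanL j r ∈ Vᗮ := by
    rw [hV, Submodule.orthogonal_closure] at hrV ⊢
    rw [Submodule.mem_orthogonal]
    intro u hu
    induction hu using Submodule.span_induction with
    | mem u hu =>
      obtain ⟨w', hw'⟩ := (hs u hu).exists_expChar
      have h1 := S.inner_koopmanL j u r
      rw [hw', inner_smul_left,
        (Submodule.mem_orthogonal _ _).1 hrV u (Submodule.subset_span hu)] at h1
      exact (mul_eq_zero.1 h1).resolve_left
        ((map_ne_zero (starRingEnd ℂ)).2 (expChar_ne_zero _))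
    | zero => exact inner_zero_left _
    | add u v _ _ hu hv => rw [inner_add_left, hu, hv, add_zero]
    | smul c u _ hu => rw [inner_smul_left, hu, mul_zero]
  have hPe : V.starProjection e ∈ V := V.starProjection_apply_mem e
  have hre : inner ℂ r e = inner ℂ r r := by
    rw [hr, inner_sub_right r, Submodule.inner_left_of_mem_orthogonal hPe hrV, sub_zero]
  have h1 : inner ℂ (S.koopmanL j r) (χ • r) = inner ℂ r r := by
    rw [← hre, ← S.inner_koopmanL j r e, hw, ← hχ]
    have : χ • r = χ • e - χ • V.starProjection e := by rw [hr, smul_sub]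
    rw [this, inner_sub_right, inner_smul_right _ (V.starProjection e),
      Submodule.inner_left_of_mem_orthogonal hPe hUr, mul_zero, sub_zero]
  rw [← sub_eq_zero, ← norm_eq_zero, ← sq_eq_zero_iff, @norm_sub_sq ℂ, h1,
    inner_self_eq_norm_sq, norm_smul, hχ, norm_expChar, one_mul]
  have h2 : ‖S.koopmanL j r‖ = ‖r‖ := (S.koopmanIso j).norm_map r
  rw [h2]
  ring

/-- If the eigenfunctions span a dense subspace, then a maximal orthonormal set of eigenfunctions
is a Hilbert basis. -/
theorem hasDiscreteSpectrum_of_topologicalClosure (S : MPSystem 𝔾 X μ)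
    (h : S.eigenSpan.topologicalClosure = ⊤) : S.HasDiscreteSpectrum := by
  obtain ⟨s, hs⟩ := zorn_subset {s : Set (Lp ℂ 2 μ) | Orthonormal ℂ (Subtype.val : s → Lp ℂ 2 μ) ∧
      ∀ f ∈ s, S.IsEigenfunction f} (by
    intro c hc hchain
    refine ⟨⋃₀ c, ⟨orthonormal_sUnion_of_directed hchain.directedOn fun t ht => (hc ht).1, ?_⟩,
      fun t ht => subset_sUnion_of_mem ht⟩
    rintro f ⟨t, ht, hft⟩
    exact (hc ht).2 f hft)
  have hso : Orthonormal ℂ (Subtype.val : s → Lp ℂ 2 μ) := hs.prop.1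
  set V := (Submodule.span ℂ s).topologicalClosure with hV
  have hmemV : ∀ e, S.IsEigenfunction e → e ∈ V := by
    intro e he
    by_contra heV
    set r := e - V.starProjection e with hr
    have hr0 : r ≠ 0 := fun h0 => heV (by
      rw [sub_eq_zero.1 h0]
      exact V.starProjection_apply_mem e)
    have hrV : r ∈ Vᗮ := V.sub_starProjection_mem_orthogonal e
    have hrE : S.IsEigenfunction r := he.sub_starProjection hs.prop.2 hr0
    have hcoe : ((‖r‖⁻¹ : ℝ) : ℂ) ≠ 0 :=
      Complex.ofReal_ne_zero.2 (inv_ne_zero (norm_ne_zero_iff.2 hr0))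
    set q := ((‖r‖⁻¹ : ℝ) : ℂ) • r with hq
    have hqV : q ∈ Vᗮ := Submodule.smul_mem _ _ hrV
    have hqn : ‖q‖ = 1 := by
      rw [hq, norm_smul, Complex.norm_real, norm_inv, norm_norm,
        inv_mul_cancel₀ (norm_ne_zero_iff.2 hr0)]
    have hqE : S.IsEigenfunction q := by
      obtain ⟨w, hw⟩ := hrE.exists_expChar
      refine ⟨smul_ne_zero hcoe hr0, w, fun j => ?_⟩
      change S.koopmanL j q = expChar _ • q
      rw [hq, map_smul, hw, smul_comm]
    have hsV : ∀ u ∈ s, inner ℂ u q = 0 := fun u hu =>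
      Submodule.inner_right_of_mem_orthogonal
        (Submodule.le_topologicalClosure _ (Submodule.subset_span hu)) hqV
    have hins : insert q s ∈ {s : Set (Lp ℂ 2 μ) |
        Orthonormal ℂ (Subtype.val : s → Lp ℂ 2 μ) ∧ ∀ f ∈ s, S.IsEigenfunction f} := by
      refine ⟨⟨?_, ?_⟩, ?_⟩
      · rintro ⟨u, rfl | hu⟩
        · exact hqn
        · exact hso.1 ⟨u, hu⟩
      · rintro ⟨u, hu⟩ ⟨v, hv⟩ huv
        have huv' : u ≠ v := fun h => huv (Subtype.ext h)
        rcases hu with rfl | hu <;> rcases hv with rfl | hv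
        · exact absurd rfl huv'
        · exact inner_eq_zero_symm.1 (hsV v hv)
        · exact hsV u hu
        · exact hso.2 (i := ⟨u, hu⟩) (j := ⟨v, hv⟩) fun h => huv' (congrArg Subtype.val h)
      · rintro u (rfl | hu)
        · exact hqE
        · exact hs.prop.2 u hu
    have hqs : q ∈ s := hs.le_of_ge hins (subset_insert q s) (mem_insert q s)
    have := hsV q hqs
    rw [inner_self_eq_zero] at this
    rw [this, norm_zero] at hqn
    exact zero_ne_one hqn
  have hVtop : V = ⊤ := by
    rw [← top_le_iff, ← h]
    exact Submodule.topologicalClosure_minimal _ (Submodule.span_le.2 hmemV)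
      (Submodule.isClosed_topologicalClosure _)
  have hbot : (Submodule.span ℂ (range (Subtype.val : s → Lp ℂ 2 μ)))ᗮ = ⊥ := by
    rw [Subtype.range_coe, ← Submodule.topologicalClosure_eq_top_iff]
    exact hVtop
  refine ⟨s, HilbertBasis.mkOfOrthogonalEqBot hso hbot, fun i => ?_, hs.prop.2⟩
  rw [HilbertBasis.coe_mkOfOrthogonalEqBot]

end MPSystem

/-! ### Discrete spectrum and weak mixing -/

namespace MPSystem

open scoped ComplexConjugate

variable {d : ℕ} {𝔾 : AddSubmonoid (Fin d → ℝ)} {ν : Measure 𝔾} {X : Type*} [MeasurableSpace X]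
  {μ : Measure X} [IsProbabilityMeasure μ]

theorem mem_Hms_of_mem_orthogonal_eigenSpan {S : MPSystem 𝔾 X μ} (h𝔾 : IsTimes d 𝔾 ν)
    (hS : S.IsErgodic) {f : Lp ℂ 2 μ} (hf0 : f ≠ 0) (hf : f ∈ S.eigenSpanᗮ) : f ∈ S.Hms ν := by
  refine mem_Hms_of_inner_tensor hS h𝔾.admissibleTimes hf0 0 (by simp) fun K hK => ?_
  rw [← inner_kernelOp, S.kernelOp_eq_zero_of_mem_orthogonal h𝔾 hK hf, inner_zero_left]

/-- If the eigenfunctions do not span a dense subspace, then a nonzero function orthogonal to all of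
them is mean sensitive. -/
theorem hasDiscreteSpectrum_iff {S : MPSystem 𝔾 X μ} (h𝔾 : IsTimes d 𝔾 ν)
    (hS : S.IsErgodic) : S.HasDiscreteSpectrum ↔ ∀ f : Lp ℂ 2 μ, f ∉ S.Hms ν := by
  constructor
  · intro h f
    refine hS.notMem_Hms_of_mem_closure h𝔾.admissibleTimes ?_
    rw [h.topologicalClosure_eigenSpan]
    trivial
  · intro h
    refine S.hasDiscreteSpectrum_of_topologicalClosure ?_
    rw [Submodule.topologicalClosure_eq_top_iff, Submodule.eq_bot_iff]
    intro f hf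
    by_contra hf0
    exact h f (mem_Hms_of_mem_orthogonal_eigenSpan h𝔾 hS hf0 hf)

/-- The constant function `1` as an element of `L²`. -/
def oneL (μ : Measure X) [IsProbabilityMeasure μ] : Lp ℂ 2 μ := Lp.const 2 μ 1

theorem coeFn_oneL : oneL μ =ᵐ[μ] fun _ => (1 : ℂ) := Lp.coeFn_const 2 μ 1

theorem inner_oneL (f : Lp ℂ 2 μ) : inner ℂ (oneL μ) f = ∫ x, f x ∂μ := by
  rw [L2.inner_def]
  refine integral_congr_ae ?_
  filter_upwards [coeFn_oneL (μ := μ)] with x hx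
  rw [hx]
  simp

theorem inner_oneL_self : inner ℂ (oneL μ) (oneL μ) = 1 := by
  rw [inner_oneL, integral_congr_ae coeFn_oneL]
  simp

theorem inner_oneL_sub (f : Lp ℂ 2 μ) :
    inner ℂ (oneL μ) (f - inner ℂ (oneL μ) f • oneL μ) = 0 := by
  rw [inner_sub_right, inner_smul_right, inner_oneL_self, mul_one, sub_self]

theorem koopmanL_oneL (S : MPSystem 𝔾 X μ) (j : 𝔾) : S.koopmanL j (oneL μ) = oneL μ := by
  refine Lp.ext ?_
  have h := (S.measurePreserving j).quasiMeasurePreserving.ae (coeFn_oneL (μ := μ))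
  filter_upwards [S.coeFn_koopman j (oneL μ), h, coeFn_oneL (μ := μ)] with x h1 h2 h3
  have h1' : S.koopmanL j (oneL μ) x = oneL μ (S.T j x) := h1
  rw [h1', h2, h3]

theorem eq_smul_oneL {f : Lp ℂ 2 μ} {c : ℂ} (h : f =ᵐ[μ] fun _ => c) : f = c • oneL μ := by
  refine Lp.ext ?_
  filter_upwards [h, Lp.coeFn_smul c (oneL μ), coeFn_oneL (μ := μ)] with x h1 h2 h3
  rw [h1, h2, Pi.smul_apply, h3, smul_eq_mul, mul_one]

/-- The function `f₀ = f - ∫ f` has mean `0`, and so has `f₀ ⊗ conj f₀`; hence the latter is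
orthogonal to the invariant functions of the product system, which are constant. -/
theorem mem_Hms_of_isWeaklyMixing {S : MPSystem 𝔾 X μ} (hν : AdmissibleTimes 𝔾 ν)
    (hS : S.IsErgodic) (hW : S.IsWeaklyMixing) {f : Lp ℂ 2 μ}
    (hf : ¬ ∃ c : ℂ, f =ᵐ[μ] fun _ => c) : f ∈ S.Hms ν := by
  set a : ℂ := inner ℂ (oneL μ) f with ha
  set f₀ : Lp ℂ 2 μ := f - a • oneL μ with hf₀
  have hae : f =ᵐ[μ] fun x => f₀ x + a := by
    filter_upwards [Lp.coeFn_sub f (a • oneL μ), Lp.coeFn_smul a (oneL μ), coeFn_oneL (μ := μ)]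
      with x h1 h2 h3
    rw [h1, Pi.sub_apply, h2, Pi.smul_apply, h3, smul_eq_mul, mul_one, sub_add_cancel]
  have h0 : f₀ ≠ 0 := by
    intro h0
    refine hf ⟨a, ?_⟩
    filter_upwards [hae, Lp.eq_zero_iff_ae_eq_zero.1 h0] with x h1 h2
    rw [h1, h2, Pi.zero_apply, zero_add]
  refine mem_Hms_of_inner_tensor hS hν h0 a hae fun K hK => ?_
  refine IsErgodic.inner_eq_zero hW hν ?_ hK
  rw [integral_congr_ae (coeFn_tensor f₀ f₀), integral_prod_mul (fun x => f₀ x)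
    (fun y => conj (f₀ y)), ← inner_oneL, inner_oneL_sub, zero_mul]

/-- If all eigenfunctions are constant, then the operator with an invariant kernel vanishes on the
functions of mean `0`, so that the kernel is constant. -/
theorem isWeaklyMixing_of_eigenfunction_const {S : MPSystem 𝔾 X μ} (h𝔾 : IsTimes d 𝔾 ν)
    (hS : S.IsErgodic)
    (h : ∀ e : Lp ℂ 2 μ, S.IsEigenfunction e → ∃ c : ℂ, e =ᵐ[μ] fun _ => c) :
    S.IsWeaklyMixing := by
  intro B hB hinv
  set K : Lp ℂ 2 (μ.prod μ) := indicatorConstLp 2 hB (measure_ne_top _ B) (1 : ℂ) with hKdef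
  have hKc : K =ᵐ[μ.prod μ] B.indicator fun _ => (1 : ℂ) := indicatorConstLp_coeFn
  have hK : ∀ j, S.selfProd.koopmanIso j K = K := by
    intro j
    refine Lp.ext ?_
    have h1 := (S.selfProd.measurePreserving j).quasiMeasurePreserving.ae hKc
    filter_upwards [S.selfProd.coeFn_koopman j K, h1, hKc] with p h2 h3 h4
    rw [koopmanIso_apply, h2, h3, h4]
    conv_rhs => rw [← hinv j]
    rfl
  have hzero : ∀ f : Lp ℂ 2 μ, inner ℂ (oneL μ) f = 0 → kernelOp K f = 0 := by
    intro f hf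
    refine S.kernelOp_eq_zero_of_mem_orthogonal h𝔾 hK ?_
    rw [mem_orthogonal_eigenSpan]
    intro e he
    obtain ⟨c, hc⟩ := h e he
    rw [eq_smul_oneL hc, inner_smul_left, hf, mul_zero]
  obtain ⟨c, hc⟩ := hS.ae_const_of_koopmanIso h𝔾.admissibleTimes
    (K := kernelOp K (oneL μ)) fun j => by
      have h1 := S.kernelOp_koopmanL hK j (oneL μ)
      rw [koopmanL_oneL] at h1
      exact h1.symm
  have hc' := eq_smul_oneL hc
  have hop : ∀ f, kernelOp K f = inner ℂ (oneL μ) f • c • oneL μ := by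
    intro f
    have h1 := hzero _ (inner_oneL_sub f)
    rw [map_sub, map_smul, sub_eq_zero] at h1
    rw [h1, hc']
  have hKeq : K = tensor (c • oneL μ) (oneL μ) := by
    rw [← sub_eq_zero]
    refine eq_zero_of_inner_tensor fun g f => ?_
    rw [← inner_conj_symm, inner_sub_left, ← inner_kernelOp, hop, inner_tensor, inner_smul_left,
      inner_conj_symm, mul_comm, sub_self, _root_.map_zero]
  have hconst : ∀ᵐ p ∂μ.prod μ, B.indicator (fun _ => (1 : ℂ)) p = c := by
    have h1 := coeFn_tensor (c • oneL μ) (oneL μ)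
    rw [← hKeq] at h1
    filter_upwards [hKc, h1, ae_fst (Lp.coeFn_smul c (oneL μ)), ae_fst (coeFn_oneL (μ := μ)),
      ae_snd (coeFn_oneL (μ := μ))] with p h2 h3 h4 h5 h6
    rw [← h2, h3, h4, Pi.smul_apply, h5, h6]
    simp
  rcases eq_or_ne c 1 with rfl | hc1
  · right
    have : ∀ᵐ p ∂μ.prod μ, p ∈ B := by
      filter_upwards [hconst] with p hp
      by_contra hpB
      simp [hpB] at hp
    exact (mem_ae_iff_prob_eq_one₀ hB.nullMeasurableSet).1 this
  · left
    rw [measure_eq_zero_iff_ae_notMem]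
    filter_upwards [hconst] with p hp hpB
    rw [indicator_of_mem hpB] at hp
    exact hc1 hp.symm

/-- Eigenfunctions are not mean sensitive, so that they have to be constant if all nonconstant
functions are mean sensitive. -/
theorem isWeaklyMixing_iff {S : MPSystem 𝔾 X μ} (h𝔾 : IsTimes d 𝔾 ν) (hS : S.IsErgodic) :
    S.IsWeaklyMixing ↔
      ∀ f : Lp ℂ 2 μ, (¬ ∃ c : ℂ, f =ᵐ[μ] fun _ => c) → f ∈ S.Hms ν := by
  refine ⟨fun hW f hf => mem_Hms_of_isWeaklyMixing h𝔾.admissibleTimes hS hW hf, fun h => ?_⟩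
  refine isWeaklyMixing_of_eigenfunction_const h𝔾 hS fun e he => ?_
  by_contra hne
  exact hS.notMem_Hms_of_mem_closure h𝔾.admissibleTimes
    (Submodule.le_topologicalClosure _ (Submodule.subset_span he)) (h e hne)

end MPSystem

end MeanSens

end

theorem mainTheorem3 {d : ℕ} {𝔾 : AddSubmonoid (Fin d → ℝ)} {ν : MeasureTheory.Measure 𝔾}
    (h𝔾 : MeanSens.IsTimes d 𝔾 ν)
    {X : Type*} [MeasurableSpace X] [StandardBorelSpace X]
    (μ : MeasureTheory.Measure X) [MeasureTheory.IsProbabilityMeasure μ]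
    (S : MeanSens.MPSystem 𝔾 X μ) (hS : S.IsErgodic) :
    (S.HasDiscreteSpectrum ↔ ∀ f : MeasureTheory.Lp ℂ 2 μ, f ∉ S.Hms ν) ∧
    (S.HasDiscreteSpectrum ↔ (Set.univ = S.Hap ∧ S.Hap = (S.Hms ν)ᶜ)) ∧
    (S.IsWeaklyMixing ↔
      ∀ f : MeasureTheory.Lp ℂ 2 μ, (¬ ∃ c : ℂ, f =ᵐ[μ] fun _ => c) → f ∈ S.Hms ν) := by
  refine ⟨MeanSens.MPSystem.hasDiscreteSpectrum_iff h𝔾 hS, ⟨fun h => ?_, fun ⟨h1, h2⟩ => ?_⟩,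
    MeanSens.MPSystem.isWeaklyMixing_iff h𝔾 hS⟩
  · have hap : S.Hap = Set.univ := Set.eq_univ_of_forall fun f =>
      S.mem_Hap_of_mem_closure (by rw [h.topologicalClosure_eigenSpan]; trivial)
    have hms : S.Hms ν = ∅ := Set.eq_empty_of_forall_notMem
      ((MeanSens.MPSystem.hasDiscreteSpectrum_iff h𝔾 hS).1 h)
    rw [hap, hms, Set.compl_empty]
    exact ⟨rfl, rfl⟩
  · refine (MeanSens.MPSystem.hasDiscreteSpectrum_iff h𝔾 hS).2 fun f hf => ?_
    have hmem : f ∈ (S.Hms ν)ᶜ := by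
      rw [← h2, ← h1]
      trivial
    exact hmem hf
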